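/- Let $M$ and $M'$ be finite matrices with entries in $\{0,1,-1\}$. For such a matrix $M$ the grid class $\mathrm{Grid}(M)$ is the set of all permutations whose plot can be divided by vertical and horizontal lines into a grid of (possibly empty) cells, one for each entry of $M$, so that the points in a cell form an increasing sequence if the corresponding entry is $1$, a decreasing sequence if it is $-1$, and the cell is empty if the entry is $0$. The growth rate of a set $\mathcal C$ of permutations is $\mathrm{gr}(\mathcal C)=\lim_{k\to\infty}|\mathcal C_k|^{1/k}$, where $\mathcal C_k$ is the set of permutations in $\mathcal C$ of length $k$. The row-column graph $G(M)$ is the bipartite graph whose vertices are the rows and the columns of $M$, a row and a column being adjacent if and only if the entry of $M$ in that row and column is non-zero. An edge $e$ of a graph $G$ lies on an endpath of $G$ if $G-e$ is disconnected and one of its components is a (possibly one-vertex) path with an endvertex of $e$ as one of its ends; otherwise $e$ is internal. Subdividing an edge means replacing it by a path with the same ends and at least one new interior vertex. An $H$ graph is a path (with at least one vertex) with two pendant edges attached to each of its two ends, where for a one-vertex path all four are attached to its only vertex, giving the star $K_{1,4}$. Suppose that $G(M)$ is connected and is neither a cycle nor an $H$ graph, and that $G(M')$ is, up to isomorphism,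 obtained from $G(M)$ by subdividing an internal edge. Then the growth rates of $\mathrm{Grid}(M)$ and $\mathrm{Grid}(M')$ exist, and $$\mathrm{gr}(\mathrm{Grid}(M'))<\mathrm{gr}(\mathrm{Grid}(M)).$$ -/

import Mathlib

namespace GridClass

/-! ### Monotone grid classes

Matrices are indexed from the lower left corner with the column index first: `M i j` is the entry in
column `i` (from the left) and row `j` (from the bottom). The entries are in `SignType = {0, 1, -1}`.
Permutations of length `k` are elements of `Equiv.Perm (Fin k)`, so positions and values are
`0, 1, ..., k - 1`. -/

/-- The points (given by their positions) of the permutation `σ` that lie in column `i` and row `j`,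
with column dividers `c` and row dividers `r`. The natural number `c i` stands for the divider
between the first `c i` positions and the remaining ones, and likewise for `r` and values. -/
def cell {t u k : ℕ} (σ : Equiv.Perm (Fin k)) (c : Fin (t + 1) → ℕ) (r : Fin (u + 1) → ℕ)
    (i : Fin t) (j : Fin u) : Set (Fin k) :=
  {p | c i.castSucc ≤ (p : ℕ) ∧ (p : ℕ) < c i.succ ∧
    r j.castSucc ≤ (σ p : ℕ) ∧ (σ p : ℕ) < r j.succ}

/-- `(c, r)` is an `M`-gridding of the permutation `σ` of length `k`. -/
structure IsGridding {t u k : ℕ} (M : Matrix (Fin t) (Fin u) SignType) (σ : Equiv.Perm (Fin k))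
    (c : Fin (t + 1) → ℕ) (r : Fin (u + 1) → ℕ) : Prop where
  col_mono : Monotone c
  col_zero : c 0 = 0
  col_last : c (Fin.last t) = k
  row_mono : Monotone r
  row_zero : r 0 = 0
  row_last : r (Fin.last u) = k
  increasing : ∀ i j, M i j = 1 → StrictMonoOn σ (cell σ c r i j)
  decreasing : ∀ i j, M i j = -1 → StrictAntiOn σ (cell σ c r i j)
  empty : ∀ i j, M i j = 0 → cell σ c r i j = ∅

/-- `Grid M k` is the set of permutations of length `k` in the grid class of `M`, that is, of those
that have an `M`-gridding. -/
def Grid {t u : ℕ} (M : Matrix (Fin t) (Fin u) SignType) (k : ℕ) : Set (Equiv.Perm (Fin k)) :=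
  {σ | ∃ c r, IsGridding M σ c r}

/-- A family of permutations, sorted by length, has growth rate `g`. -/
def HasGrowthRate (C : (k : ℕ) → Set (Equiv.Perm (Fin k))) (g : ℝ) : Prop :=
  Filter.Tendsto (fun k : ℕ => ((C k).ncard : ℝ) ^ (1 / (k : ℝ))) Filter.atTop (nhds g)

/-- The row-column graph of `M`: the vertices are the columns `Sum.inl i` and the rows `Sum.inr j`,
and column `i` is joined to row `j` exactly if the entry `M i j` is not zero. -/
def rowColumnGraph {t u : ℕ} (M : Matrix (Fin t) (Fin u) SignType) :
    SimpleGraph (Fin t ⊕ Fin u) where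
  Adj
    | Sum.inl i, Sum.inr j => M i j ≠ 0
    | Sum.inr j, Sum.inl i => M i j ≠ 0
    | _, _ => False
  symm := ⟨by rintro (_ | _) (_ | _) h <;> exact h⟩
  loopless := ⟨by rintro (_ | _) h <;> exact h⟩

/-! ### Graphs -/

/-- The edge `e` lies on an endpath of `G`: removing `e` disconnects `G`, and one of the resulting
components is a (possibly trivial) path which has an endvertex of `e` as its first vertex. -/
def LiesOnEndpath {V : Type*} (G : SimpleGraph V) (e : Sym2 V) : Prop :=
  ¬ (G.deleteEdges {e}).Connected ∧
    ∃ v ∈ e, ∃ (n : ℕ) (φ : SimpleGraph.pathGraph (n + 1) ≃g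
      ((G.deleteEdges {e}).connectedComponentMk v).toSimpleGraph), (φ 0 : V) = v

/-- An internal edge is an edge that does not lie on an endpath. -/
def IsInternalEdge {V : Type*} (G : SimpleGraph V) (e : Sym2 V) : Prop :=
  e ∈ G.edgeSet ∧ ¬ LiesOnEndpath G e

/-- For an edge `a b` of `G` and `n ≥ 1`, the graph obtained from `G` by replacing this edge with a
path `a, x 0, x 1, ..., x (n - 1), b` through `n` new vertices `x i = Sum.inr i`. -/
def subdivideEdge {V : Type*} (G : SimpleGraph V) (a b : V) (n : ℕ) :
    SimpleGraph (V ⊕ Fin n) where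
  Adj
    | Sum.inl v, Sum.inl w => G.Adj v w ∧ s(v, w) ≠ s(a, b)
    | Sum.inl v, Sum.inr i => (v = a ∧ (i : ℕ) = 0) ∨ (v = b ∧ (i : ℕ) + 1 = n)
    | Sum.inr i, Sum.inl v => (v = a ∧ (i : ℕ) = 0) ∨ (v = b ∧ (i : ℕ) + 1 = n)
    | Sum.inr i, Sum.inr j => (i : ℕ) + 1 = j ∨ (j : ℕ) + 1 = i
  symm := ⟨by
    rintro (v | i) (w | j) h
    · exact ⟨h.1.symm, by rw [Sym2.eq_swap]; exact h.2⟩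
    · exact h
    · exact h
    · exact h.symm⟩
  loopless := ⟨by
    rintro (v | i) h
    · exact G.irrefl h.1
    · rcases h with h | h <;> omega⟩

/-- `H` is (isomorphic to) a graph obtained from `G` by subdividing the edge `e`, which means
placing one or more new vertices on it. -/
def IsSubdivisionAt {V W : Type*} (G : SimpleGraph V) (e : Sym2 V) (H : SimpleGraph W) : Prop :=
  ∃ (a b : V) (n : ℕ), e = s(a, b) ∧ 1 ≤ n ∧ Nonempty (H ≃g subdivideEdge G a b n)

/-- `G` is a cycle. -/
def IsCycleGraph {V : Type*} (G : SimpleGraph V) : Prop :=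
  ∃ n : ℕ, 3 ≤ n ∧ Nonempty (G ≃g SimpleGraph.cycleGraph n)

/-- The `H` graph whose central path has the `n + 1` vertices `Sum.inl i`: two pendant vertices
`Sum.inr (false, _)` are attached to its first vertex and two pendant vertices `Sum.inr (true, _)` to
its last vertex. For `n = 0` this is the star with four leaves. -/
def hGraph (n : ℕ) : SimpleGraph (Fin (n + 1) ⊕ (Bool × Bool)) where
  Adj
    | Sum.inl i, Sum.inl j => (SimpleGraph.pathGraph (n + 1)).Adj i j
    | Sum.inl i, Sum.inr p => i = if p.1 then Fin.last n else 0
    | Sum.inr p, Sum.inl i => i = if p.1 then Fin.last n else 0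
    | Sum.inr _, Sum.inr _ => False
  symm := ⟨by
    rintro (i | p) (j | q) h
    · exact SimpleGraph.Adj.symm h
    · exact h
    · exact h
    · exact h⟩
  loopless := ⟨by
    rintro (i | p) h
    · exact SimpleGraph.irrefl _ h
    · exact h⟩

/-- `G` is an `H` graph. -/
def IsHGraph {V : Type*} (G : SimpleGraph V) : Prop :=
  ∃ n : ℕ, Nonempty (G ≃g hGraph n)

end GridClass

namespace GridClass

/-! ### Positive eigenvectors -/

/-! The growth rate of `Grid M` is the square of the Perron eigenvalue `lam` of the row-column
graph, so the theorem reduces to the spectral statement that subdividing an internal edge lowers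
this eigenvalue.

Growth rate (`hasGrowthRate_grid`): with the dividers fixed, a gridded permutation is determined by
two words, recording how the cells of each column interleave and how those of each row do. Let `f`
be the Perron vector. Choosing letters at random with transition probabilities `f w / (lam * f v)`
gives every gridded permutation of length `k` the weight `lam ^ (-2 * k)`, and there are only
polynomially many choices of dividers. Conversely, multinomial coefficients for cell frequencies
proportional to `f i * f j` attain the same exponential rate.

Eigenvalue: by `IsPerron.lt_of_subinvariant` it suffices to find a positive vector on the subdivided
graph that is subinvariant for `lam`, strictly somewhere. From an internal edge the graph branches
in both directions (`treeEnd_or_branchEnd`, where cycles are excluded). If `lam ≤ 2`, concavity of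
`f` along the connecting path would force an `H` graph, so `lam > 2` (`two_lt_of_branchEnds`). The
vector is then built by modifying `f` near the edge, after sliding the subdivision along vertices of
degree two to a suitable place (`hasStrictSubinvariant_subdivideEdge`). -/

open Classical in
/-- The sum of the values of `f` at the neighbours of `v`. -/
noncomputable def nbrSum {V : Type*} [Fintype V] (G : SimpleGraph V) (f : V → ℝ) (v : V) : ℝ :=
  ∑ w, if G.Adj v w then f w else 0

/-- `f` is a positive eigenvector of the adjacency matrix of `G`, with eigenvalue `lam`. -/
structure IsPerron {V : Type*} [Fintype V] (G : SimpleGraph V) (lam : ℝ) (f : V → ℝ) : Prop where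
  pos : ∀ v, 0 < f v
  eq : ∀ v, nbrSum G f v = lam * f v

theorem forall_of_connected {V : Type*} {G : SimpleGraph V} (hG : G.Connected)
    {P : V → Prop} {v : V} (hv : P v)
    (hP : ∀ v w, G.Adj v w → P v → P w) (w : V) : P w := by
  obtain ⟨p⟩ := hG.preconnected v w
  induction p with
  | nil => exact hv
  | cons h _ ih => exact ih (hP _ _ h hv)

section Perron

variable {V : Type*} [Fintype V] {G : SimpleGraph V}

theorem sum_mul_nbrSum_comm (G : SimpleGraph V) (f g : V → ℝ) :
    ∑ v, g v * nbrSum G f v = ∑ v, nbrSum G g v * f v := by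
  classical
  simp only [nbrSum, Finset.mul_sum, Finset.sum_mul]
  rw [Finset.sum_comm]
  refine Finset.sum_congr rfl fun v _ => Finset.sum_congr rfl fun w _ => ?_
  by_cases h : G.Adj v w
  · simp [h, h.symm]
  · simp [h, G.adj_comm w v]

theorem nbrSum_add_smul (G : SimpleGraph V) (f g : V → ℝ) (s : ℝ) (v : V) :
    nbrSum G (fun w => f w + s * g w) v = nbrSum G f v + s * nbrSum G g v := by
  classical
  simp only [nbrSum, Finset.mul_sum, ← Finset.sum_add_distrib]
  refine Finset.sum_congr rfl fun w _ => ?_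
  split_ifs <;> simp

theorem nbrSum_mono {f g : V → ℝ} (h : ∀ v, f v ≤ g v) (v : V) : nbrSum G f v ≤ nbrSum G g v := by
  classical
  refine Finset.sum_le_sum fun w _ => ?_
  split_ifs
  · exact h w
  · rfl

theorem le_nbrSum {f : V → ℝ} (h : ∀ v, 0 ≤ f v) {v w : V} (hvw : G.Adj v w) :
    f w ≤ nbrSum G f v := by
  classical
  have := Finset.single_le_sum (f := fun w => if G.Adj v w then f w else 0)
    (fun w _ => by split_ifs; exacts [h w, le_rfl]) (Finset.mem_univ w)
  simpa [hvw, nbrSum] using this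

theorem nbrSum_iso {W : Type*} [Fintype W] {H : SimpleGraph W} (φ : G ≃g H) (f : W → ℝ) (v : V) :
    nbrSum G (fun w => f (φ w)) v = nbrSum H f (φ v) := by
  classical
  unfold nbrSum
  rw [← Equiv.sum_comp φ.toEquiv]
  refine Finset.sum_congr rfl fun w _ => ?_
  simp [φ.map_adj_iff]

theorem IsPerron.iso {W : Type*} [Fintype W] {H : SimpleGraph W} (φ : G ≃g H) {lam : ℝ}
    {f : W → ℝ} (h : IsPerron H lam f) : IsPerron G lam (fun v => f (φ v)) :=
  ⟨fun v => h.pos _, fun v => by rw [nbrSum_iso, h.eq]⟩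

/-- Adjacency entries are nonnegative; hence the form may be maximised over nonnegative vectors
only. -/
theorem quadratic_form_abs_le (f : V → ℝ) :
    ∑ v, f v * nbrSum G f v ≤ ∑ v, |f v| * nbrSum G (fun w => |f w|) v := by
  classical
  refine Finset.sum_le_sum fun v _ => ?_
  calc f v * nbrSum G f v ≤ |f v| * |nbrSum G f v| := by rw [← abs_mul]; exact le_abs_self _
    _ ≤ _ := by
      refine mul_le_mul_of_nonneg_left ?_ (abs_nonneg _)
      refine (Finset.abs_sum_le_sum_abs _ _).trans (Finset.sum_le_sum fun w _ => ?_)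
      split_ifs <;> simp

/-- A symmetric quadratic form bounded by `lam` times the square norm attains this bound only at
eigenvectors. -/
theorem nbrSum_eq_of_maximizer {lam : ℝ} {f : V → ℝ}
    (hle : ∀ g : V → ℝ, ∑ v, g v * nbrSum G g v ≤ lam * ∑ v, g v ^ 2)
    (hf : ∑ v, f v * nbrSum G f v = lam * ∑ v, f v ^ 2) (v : V) :
    nbrSum G f v = lam * f v := by
  classical
  set d : V → ℝ := fun v => nbrSum G f v - lam * f v with hd
  -- Perturb `f` in the direction of its defect `d`. The bound is an equality at `s = 0`, so the
  -- linear term in `s`, which is twice the square norm of `d`, has to vanish.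
  have key : ∀ s : ℝ, 2 * s * ∑ v, d v ^ 2 ≤
      s ^ 2 * (lam * ∑ v, d v ^ 2 - ∑ v, d v * nbrSum G d v) := by
    intro s
    have h1 := hle (fun w => f w + s * d w)
    have h2 : ∑ v, (f v + s * d v) * nbrSum G (fun w => f w + s * d w) v =
        ∑ v, f v * nbrSum G f v + 2 * s * ∑ v, d v * nbrSum G f v
          + s ^ 2 * ∑ v, d v * nbrSum G d v := by
      have h3 : ∑ v, f v * nbrSum G d v = ∑ v, d v * nbrSum G f v := by
        rw [sum_mul_nbrSum_comm]
        exact Finset.sum_congr rfl fun _ _ => mul_comm _ _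
      have h4 : ∀ v, (f v + s * d v) * nbrSum G (fun w => f w + s * d w) v =
          f v * nbrSum G f v + s * (f v * nbrSum G d v) + s * (d v * nbrSum G f v)
            + s ^ 2 * (d v * nbrSum G d v) := by
        intro v; rw [nbrSum_add_smul]; ring
      simp only [h4, Finset.sum_add_distrib, ← Finset.mul_sum, h3]
      ring
    have h5 : ∑ v, (f v + s * d v) ^ 2 =
        ∑ v, f v ^ 2 + 2 * s * ∑ v, d v * f v + s ^ 2 * ∑ v, d v ^ 2 := by
      have h4 : ∀ v, (f v + s * d v) ^ 2 = f v ^ 2 + 2 * s * (d v * f v) + s ^ 2 * d v ^ 2 := by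
        intro v; ring
      simp only [h4, Finset.sum_add_distrib, ← Finset.mul_sum]
    have h6 : ∑ v, d v ^ 2 = ∑ v, d v * nbrSum G f v - lam * ∑ v, d v * f v := by
      rw [Finset.mul_sum, ← Finset.sum_sub_distrib]
      exact Finset.sum_congr rfl fun v _ => by simp only [hd]; ring
    rw [h2, h5, hf] at h1
    linear_combination h1 + 2 * s * h6
  set D := ∑ v, d v ^ 2 with hD
  set C := lam * D - ∑ v, d v * nbrSum G d v with hC
  have hD0 : 0 ≤ D := Finset.sum_nonneg fun v _ => sq_nonneg _
  have hDz : D = 0 := by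
    by_contra hne
    have hpos : 0 < D := lt_of_le_of_ne hD0 (Ne.symm hne)
    have h1 := key 1
    have hCpos : 0 < C := by linarith
    have h2 := key (D / C)
    have h3 : (D / C) ^ 2 * C = D / C * D := by field_simp
    rw [h3] at h2
    have : 0 < D / C * D := by positivity
    nlinarith
  have := (Finset.sum_eq_zero_iff_of_nonneg (fun v _ => sq_nonneg (d v))).1 (hD ▸ hDz) v
    (Finset.mem_univ v)
  have : d v = 0 := by simpa using this
  simp only [hd] at this
  linarith

theorem continuous_nbrSum (v : V) : Continuous fun f : V → ℝ => nbrSum G f v := by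
  classical
  unfold nbrSum
  refine continuous_finsetSum _ fun w _ => ?_
  split_ifs <;> fun_prop

/-- The quadratic form has a maximiser on the compact nonnegative part of the unit sphere. By
passing to absolute values it is maximal among all unit vectors, hence an eigenvector. A zero of it
would spread to all neighbours and, by connectedness, everywhere. -/
theorem exists_isPerron (hG : G.Connected) : ∃ lam f, IsPerron G lam f := by
  classical
  have := hG.nonempty
  let K : Set (V → ℝ) := {f | (∀ v, f v ∈ Set.Icc (0 : ℝ) 1) ∧ ∑ v, f v ^ 2 = 1}
  have hK : IsCompact K := by
    have h1 : IsCompact (Set.univ.pi fun _ : V => Set.Icc (0 : ℝ) 1) :=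
      isCompact_univ_pi fun _ => isCompact_Icc
    have h2 : IsClosed {f : V → ℝ | ∑ v, f v ^ 2 = 1} :=
      isClosed_eq (by fun_prop) continuous_const
    convert h1.inter_right h2 using 1
    ext f; simp only [K, Set.mem_inter_iff, Set.mem_univ_pi, Set.mem_ofPred_eq]
  obtain ⟨v₀⟩ := this
  have hne : K.Nonempty := by
    refine ⟨Pi.single v₀ 1, fun v => ?_, ?_⟩
    · by_cases h : v = v₀
      · subst h; simp
      · simp [h]
    · rw [Finset.sum_eq_single v₀] <;> simp +contextual
  obtain ⟨f, hf, hmax⟩ := hK.exists_isMaxOn hne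
    (f := fun f : V → ℝ => ∑ v, f v * nbrSum G f v)
    (Continuous.continuousOn (continuous_finsetSum _ fun v _ =>
      (continuous_apply v).mul (continuous_nbrSum v)))
  set lam := ∑ v, f v * nbrSum G f v with hlam
  have hle : ∀ g : V → ℝ, ∑ v, g v * nbrSum G g v ≤ lam * ∑ v, g v ^ 2 := by
    intro g
    refine (quadratic_form_abs_le g).trans ?_
    set N := ∑ v, g v ^ 2 with hN
    have hN0 : 0 ≤ N := Finset.sum_nonneg fun v _ => sq_nonneg _
    rcases hN0.eq_or_lt with h0 | hpos
    · have hg : ∀ v, g v = 0 := fun v => by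
        have := (Finset.sum_eq_zero_iff_of_nonneg (fun v _ => sq_nonneg (g v))).1 h0.symm v
          (Finset.mem_univ v)
        simpa using this
      simp [← h0, hg]
    · set q := Real.sqrt N with hq
      have hq0 : 0 < q := Real.sqrt_pos.2 hpos
      have hq2 : q ^ 2 = N := Real.sq_sqrt hN0
      have hmem : (fun v => |g v| / q) ∈ K := by
        refine ⟨fun v => ⟨by positivity, ?_⟩, ?_⟩
        · rw [div_le_one hq0]
          refine Real.le_sqrt_of_sq_le ?_
          rw [sq_abs]
          exact Finset.single_le_sum (f := fun v => g v ^ 2) (fun v _ => sq_nonneg _)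
            (Finset.mem_univ v)
        · simp only [div_pow, sq_abs, ← Finset.sum_div, hq2]
          exact div_self hpos.ne'
      have h1 := hmax hmem
      have h2 : ∀ v, nbrSum G (fun v => |g v| / q) v = nbrSum G (fun v => |g v|) v / q := by
        intro v
        unfold nbrSum
        rw [Finset.sum_div]
        exact Finset.sum_congr rfl fun w _ => by split_ifs <;> simp
      have h3 : ∑ v, |g v| / q * nbrSum G (fun v => |g v| / q) v =
          (∑ v, |g v| * nbrSum G (fun v => |g v|) v) / N := by
        rw [Finset.sum_div, ← hq2]
        exact Finset.sum_congr rfl fun w _ => by rw [h2]; field_simp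
      simp only [Set.mem_ofPred_eq, h3] at h1
      exact (div_le_iff₀ hpos).1 h1
  have heq := nbrSum_eq_of_maximizer hle (by rw [hf.2, mul_one])
  refine ⟨lam, f, fun v => ?_, heq⟩
  refine lt_of_le_of_ne (hf.1 v).1 fun h0 => ?_
  have hall : ∀ w, f w = 0 := by
    refine forall_of_connected hG (P := fun w => f w = 0) h0.symm fun a b hab ha => ?_
    have h1 := le_nbrSum (fun v => (hf.1 v).1) hab
    rw [heq, ha, mul_zero] at h1
    exact le_antisymm h1 (hf.1 b).1
  have := hf.2
  simp [hall] at this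

theorem IsPerron.lam_pos {lam : ℝ} {f : V → ℝ} (h : IsPerron G lam f) {v w : V}
    (hvw : G.Adj v w) : 0 < lam := by
  have h1 := le_nbrSum (fun v => (h.pos v).le) hvw
  rw [h.eq] at h1
  exact pos_of_mul_pos_left ((h.pos w).trans_le h1) (h.pos v).le

/-- A positive vector which is subinvariant, strictly at some vertex, bounds the eigenvalue. -/
theorem IsPerron.lt_of_subinvariant {lam mu : ℝ} {f g : V → ℝ} (h : IsPerron G lam f)
    (hg : ∀ v, nbrSum G g v ≤ mu * g v) (hgpos : ∀ v, 0 < g v)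
    {v : V} (hv : nbrSum G g v < mu * g v) : lam < mu := by
  -- Pair with the positive eigenvector `f`: by symmetry the left side is `lam` times the inner
  -- product of `f` and `g`.
  have h1 : ∑ v, f v * nbrSum G g v < ∑ v, f v * (mu * g v) :=
    Finset.sum_lt_sum (fun v _ => mul_le_mul_of_nonneg_left (hg v) (h.pos v).le)
      ⟨v, Finset.mem_univ v, mul_lt_mul_of_pos_left hv (h.pos v)⟩
  rw [sum_mul_nbrSum_comm] at h1
  have h2 : ∑ v, f v * (mu * g v) = mu * ∑ v, f v * g v := by
    rw [Finset.mul_sum]; exact Finset.sum_congr rfl fun _ _ => by ring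
  have h3 : ∑ v, nbrSum G f v * g v = lam * ∑ v, f v * g v := by
    rw [Finset.mul_sum]; exact Finset.sum_congr rfl fun _ _ => by rw [h.eq]; ring
  rw [h2, h3] at h1
  exact lt_of_mul_lt_mul_right h1
    (Finset.sum_nonneg fun v _ => mul_nonneg (h.pos v).le (hgpos v).le)

end Perron

/-! ### Counting gridded permutations -/

/-! ### Dividers and the blocks they cut out -/

section Blocks

theorem exists_blockIndex {t k : ℕ} {c : Fin (t + 1) → ℕ} (hc : Monotone c) (h0 : c 0 = 0)
    (hl : c (Fin.last t) = k) :
    ∃ col : Fin k → Fin t, ∀ (p : Fin k) i, (c i.castSucc ≤ (p : ℕ) ∧ (p : ℕ) < c i.succ) ↔ col p = i := by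
  have hex : ∀ p : Fin k, ∃ i : Fin t, c i.castSucc ≤ (p : ℕ) ∧ (p : ℕ) < c i.succ := by
    intro p
    by_contra! h
    have : ∀ i, c i ≤ (p : ℕ) := fun i => by
      induction i using Fin.induction with
      | zero => simp [h0]
      | succ i ih => exact h i ih
    have := this (Fin.last t)
    have := p.2
    omega
  choose col hcol using hex
  refine ⟨col, fun p i => ⟨fun h => ?_, fun h => h ▸ hcol p⟩⟩
  by_contra hne
  rcases lt_or_gt_of_ne hne with hlt | hlt
  · have : c (col p).succ ≤ c i.castSucc := hc (Fin.succ_le_castSucc_iff.2 hlt)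
    have := (hcol p).2
    omega
  · have : c i.succ ≤ c (col p).castSucc := hc (Fin.succ_le_castSucc_iff.2 hlt)
    have := (hcol p).1
    omega

theorem cell_eq {t u k : ℕ} {c : Fin (t + 1) → ℕ} {r : Fin (u + 1) → ℕ}
    {col : Fin k → Fin t} {row : Fin k → Fin u}
    (hcol : ∀ (p : Fin k) i, (c i.castSucc ≤ (p : ℕ) ∧ (p : ℕ) < c i.succ) ↔ col p = i)
    (hrow : ∀ (p : Fin k) j, (r j.castSucc ≤ (p : ℕ) ∧ (p : ℕ) < r j.succ) ↔ row p = j)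
    (σ : Equiv.Perm (Fin k)) (i : Fin t) (j : Fin u) :
    cell σ c r i j = {p | col p = i ∧ row (σ p) = j} := by
  ext p
  simp only [cell, Set.mem_ofPred_eq, ← hcol, ← hrow, and_assoc]

theorem exists_dividers {t k : ℕ} (n : Fin t → ℕ) (hn : ∑ i, n i = k) :
    ∃ c : Fin (t + 1) → ℕ, Monotone c ∧ c 0 = 0 ∧ c (Fin.last t) = k ∧
      ∃ col : Fin k → Fin t,
        (∀ (p : Fin k) i, (c i.castSucc ≤ (p : ℕ) ∧ (p : ℕ) < c i.succ) ↔ col p = i) ∧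
        ∀ i, Nat.card {p // col p = i} = n i := by
  classical
  set c : Fin (t + 1) → ℕ := fun i => ∑ l with l.castSucc < i, n l with hc
  have hmono : Monotone c := fun i j hij =>
    Finset.sum_le_sum_of_subset fun l hl => by
      simp only [Finset.mem_filter, Finset.mem_univ, true_and] at hl ⊢
      exact hl.trans_le hij
  have h0 : c 0 = 0 := by simp [hc]
  have hl : c (Fin.last t) = k := by simp [hc, Fin.castSucc_lt_last, hn]
  have hs : ∀ i : Fin t, c i.succ = c i.castSucc + n i := by
    intro i
    simp only [hc, Fin.castSucc_lt_succ_iff, Fin.castSucc_lt_castSucc_iff]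
    have : (Finset.univ.filter fun l : Fin t => l ≤ i) =
        insert i (Finset.univ.filter fun l : Fin t => l < i) := by
      ext l; simp [le_iff_lt_or_eq, or_comm]
    rw [this, Finset.sum_insert (by simp), add_comm]
  obtain ⟨col, hcol⟩ := exists_blockIndex hmono h0 hl
  refine ⟨c, hmono, h0, hl, col, hcol, fun i => ?_⟩
  have hle : c i.succ ≤ k := hl ▸ hmono (Fin.le_last _)
  rw [Nat.card_eq_fintype_card, Fintype.card_subtype]
  have : (Finset.univ.filter fun p => col p = i).map Fin.valEmbedding =
      Finset.Ico (c i.castSucc) (c i.succ) := by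
    ext x
    simp only [Finset.mem_map, Finset.mem_filter, Finset.mem_univ, true_and, Finset.mem_Ico,
      ← hcol, Fin.valEmbedding_apply]
    constructor
    · rintro ⟨p, hp, rfl⟩; exact hp
    · intro h; exact ⟨⟨x, by omega⟩, h, rfl⟩
  rw [← Finset.card_map Fin.valEmbedding, this, Nat.card_Ico, hs]
  omega

end Blocks

/-! ### Upper bound on the number of gridded permutations -/

section Upper

/-- At the least point `p` that moves, both `ρ p` and `ρ.symm p` exceed `p`. Since `p` and `ρ.symm
p` share a fibre, `ρ` would reverse their order. -/
theorem perm_eq_one_of_monotone_on_fibers {k : ℕ} {ι : Type*} (F : Fin k → ι)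
    (ρ : Equiv.Perm (Fin k)) (hF : ∀ p, F (ρ p) = F p)
    (hρ : ∀ p q, F p = F q → p < q → ρ p < ρ q) : ρ = 1 := by
  ext p
  congr 1
  induction p using WellFoundedLT.induction with
  | ind p ih =>
    simp only [Equiv.Perm.coe_one, id_eq] at ih ⊢
    by_contra hne
    have hgt : p < ρ p := by
      rcases lt_or_gt_of_ne hne with h | h
      · exact absurd (ρ.injective (ih _ h)) hne
      · exact h
    have hq : ρ (ρ.symm p) = p := ρ.apply_symm_apply p
    have hq1 : p < ρ.symm p := by
      rcases lt_trichotomy p (ρ.symm p) with h | h | h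
      · exact h
      · rw [← h] at hq; exact absurd hq hne
      · have := ih _ h
        rw [hq] at this
        exact absurd h (by rw [← this]; exact lt_irrefl _)
    have := hρ p (ρ.symm p) (by rw [← hF (ρ.symm p), hq]) hq1
    rw [hq] at this
    exact lt_asymm this hgt

variable {t u k : ℕ} {M : Matrix (Fin t) (Fin u) SignType}

/-- The permutation "`σ`, then the inverse of `τ`" maps each cell of `σ` to the same cell of `τ`. It
is increasing there because both are monotone in the direction prescribed by `M`, so it is the
identity. -/
theorem IsGridding.ext_of_words {c : Fin (t + 1) → ℕ} {r : Fin (u + 1) → ℕ}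
    {col : Fin k → Fin t} {row : Fin k → Fin u}
    (hcol : ∀ (p : Fin k) i, (c i.castSucc ≤ (p : ℕ) ∧ (p : ℕ) < c i.succ) ↔ col p = i)
    (hrow : ∀ (p : Fin k) j, (r j.castSucc ≤ (p : ℕ) ∧ (p : ℕ) < r j.succ) ↔ row p = j)
    {σ τ : Equiv.Perm (Fin k)} (hσ : IsGridding M σ c r) (hτ : IsGridding M τ c r)
    (h1 : ∀ p, row (σ p) = row (τ p)) (h2 : ∀ v, col (σ.symm v) = col (τ.symm v)) : σ = τ := by
  set ρ : Equiv.Perm (Fin k) := σ.trans τ.symm with hρ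
  have hτρ : ∀ p, τ (ρ p) = σ p := fun p => by simp [hρ]
  have hcolρ : ∀ p, col (ρ p) = col p := fun p => by
    have := h2 (σ p)
    simpa [hρ] using this.symm
  have hone : ρ = 1 := by
    refine perm_eq_one_of_monotone_on_fibers (fun p => (col p, row (τ p))) ρ
      (fun p => by simp only [hcolρ, hτρ, h1]) fun p q hpq hlt => ?_
    simp only [Prod.mk.injEq] at hpq
    have m1 : ∀ x, col x = col p → row (τ x) = row (τ p) → x ∈ cell σ c r (col p) (row (τ p)) :=
      fun x hx hx' => by rw [cell_eq hcol hrow]; exact ⟨hx, by rw [h1, hx']⟩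
    have m2 : ∀ x, col x = col p → row (τ x) = row (τ p) →
        ρ x ∈ cell τ c r (col p) (row (τ p)) :=
      fun x hx hx' => by rw [cell_eq hcol hrow]; exact ⟨by rw [hcolρ, hx], by rw [hτρ, h1, hx']⟩
    have hp1 := m1 p rfl rfl
    have hq1 := m1 q hpq.1.symm hpq.2.symm
    have hp2 := m2 p rfl rfl
    have hq2 := m2 q hpq.1.symm hpq.2.symm
    rcases hM : M (col p) (row (τ p)) with _ | _ | _
    · have := hσ.empty _ _ hM
      rw [this] at hp1
      exact hp1.elim
    · have h := hσ.decreasing _ _ hM hp1 hq1 hlt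
      rw [← hτρ p, ← hτρ q] at h
      exact ((hτ.decreasing _ _ hM).lt_iff_gt hq2 hp2).1 h
    · have h := hσ.increasing _ _ hM hp1 hq1 hlt
      rw [← hτρ p, ← hτρ q] at h
      exact ((hτ.increasing _ _ hM).lt_iff_lt hp2 hq2).1 h
  ext p
  rw [← hτρ p, hone]
  simp

theorem rowColumnGraph_adj_inl_inl {i i' : Fin t} :
    ¬ (rowColumnGraph M).Adj (.inl i) (.inl i') := fun h => h

theorem rowColumnGraph_adj_inr_inr {j j' : Fin u} :
    ¬ (rowColumnGraph M).Adj (.inr j) (.inr j') := fun h => h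

theorem rowColumnGraph_adj_inl_inr {i : Fin t} {j : Fin u} :
    (rowColumnGraph M).Adj (.inl i) (.inr j) ↔ M i j ≠ 0 := Iff.rfl

theorem rowColumnGraph_adj_inr_inl {i : Fin t} {j : Fin u} :
    (rowColumnGraph M).Adj (.inr j) (.inl i) ↔ M i j ≠ 0 := Iff.rfl

theorem nbrSum_rowColumnGraph_inl (f : Fin t ⊕ Fin u → ℝ) (i : Fin t) :
    nbrSum (rowColumnGraph M) f (.inl i) = ∑ j, if M i j ≠ 0 then f (.inr j) else 0 := by
  classical
  rw [nbrSum, Fintype.sum_sum_type]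
  simp only [rowColumnGraph_adj_inl_inl, rowColumnGraph_adj_inl_inr, if_false,
    Finset.sum_const_zero, zero_add]

theorem nbrSum_rowColumnGraph_inr (f : Fin t ⊕ Fin u → ℝ) (j : Fin u) :
    nbrSum (rowColumnGraph M) f (.inr j) = ∑ i, if M i j ≠ 0 then f (.inl i) else 0 := by
  classical
  rw [nbrSum, Fintype.sum_sum_type]
  simp only [rowColumnGraph_adj_inr_inr, rowColumnGraph_adj_inr_inl, if_false,
    Finset.sum_const_zero, add_zero]

/-- The eigenvalue equation, normalised, turns the Perron vector into a probability distribution on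
the rows that meet column `i`. -/
theorem sum_inl_weights {lam : ℝ} {f : Fin t ⊕ Fin u → ℝ}
    (h : IsPerron (rowColumnGraph M) lam f) (hlam : 0 < lam) (i : Fin t) :
    ∑ j, (if M i j ≠ 0 then f (.inr j) / (lam * f (.inl i)) else 0) = 1 := by
  have h1 := h.eq (.inl i)
  have hpos := (mul_pos hlam (h.pos (.inl i))).ne'
  rw [nbrSum_rowColumnGraph_inl] at h1
  rw [← div_self hpos]
  nth_rewrite 2 [← h1]
  rw [Finset.sum_div]
  exact Finset.sum_congr rfl fun j _ => by split_ifs <;> simp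

theorem sum_inr_weights {lam : ℝ} {f : Fin t ⊕ Fin u → ℝ}
    (h : IsPerron (rowColumnGraph M) lam f) (hlam : 0 < lam) (j : Fin u) :
    ∑ i, (if M i j ≠ 0 then f (.inl i) / (lam * f (.inr j)) else 0) = 1 := by
  have h1 := h.eq (.inr j)
  have hpos := (mul_pos hlam (h.pos (.inr j))).ne'
  rw [nbrSum_rowColumnGraph_inr] at h1
  rw [← div_self hpos]
  nth_rewrite 2 [← h1]
  rw [Finset.sum_div]
  exact Finset.sum_congr rfl fun j _ => by split_ifs <;> simp

/-- The number of permutations with a given gridding is at most `lam ^ (2 * k)`. -/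
theorem ncard_gridded_le {lam : ℝ} {f : Fin t ⊕ Fin u → ℝ}
    (h : IsPerron (rowColumnGraph M) lam f) (hlam : 0 < lam)
    (c : Fin (t + 1) → ℕ) (r : Fin (u + 1) → ℕ) :
    (({σ : Equiv.Perm (Fin k) | IsGridding M σ c r}).ncard : ℝ) ≤ (lam ^ 2) ^ k := by
  classical
  rcases Set.eq_empty_or_nonempty {σ : Equiv.Perm (Fin k) | IsGridding M σ c r} with h0 | ⟨σ₀, hσ₀⟩
  · rw [h0, Set.ncard_empty]; simp; positivity
  obtain ⟨col, hcol⟩ := exists_blockIndex hσ₀.col_mono hσ₀.col_zero hσ₀.col_last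
  obtain ⟨row, hrow⟩ := exists_blockIndex hσ₀.row_mono hσ₀.row_zero hσ₀.row_last
  -- `P` and `Q` are the probabilities of the two words when all letters are drawn independently
  -- from the distributions above.
  set P : (Fin k → Fin u) → ℝ := fun w =>
    ∏ p, (if M (col p) (w p) ≠ 0 then f (.inr (w p)) / (lam * f (.inl (col p))) else 0) with hP
  set Q : (Fin k → Fin t) → ℝ := fun z =>
    ∏ v, (if M (z v) (row v) ≠ 0 then f (.inl (z v)) / (lam * f (.inr (row v))) else 0) with hQ
  have hPsum : ∑ w, P w = 1 := by
    have := Finset.prod_univ_sum (fun _ : Fin k => (Finset.univ : Finset (Fin u)))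
      (fun p j => if M (col p) j ≠ 0 then f (.inr j) / (lam * f (.inl (col p))) else 0)
    rw [Fintype.piFinset_univ] at this
    rw [hP, ← this]
    exact Finset.prod_eq_one fun p _ => sum_inl_weights h hlam _
  have hQsum : ∑ z, Q z = 1 := by
    have := Finset.prod_univ_sum (fun _ : Fin k => (Finset.univ : Finset (Fin t)))
      (fun v i => if M i (row v) ≠ 0 then f (.inl i) / (lam * f (.inr (row v))) else 0)
    rw [Fintype.piFinset_univ] at this
    rw [hQ, ← this]
    exact Finset.prod_eq_one fun p _ => sum_inr_weights h hlam _
  have hP0 : ∀ w, 0 ≤ P w := fun w => Finset.prod_nonneg fun p _ => by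
    split_ifs
    · exact div_nonneg (h.pos _).le (mul_pos hlam (h.pos _)).le
    · rfl
  have hQ0 : ∀ w, 0 ≤ Q w := fun w => Finset.prod_nonneg fun p _ => by
    split_ifs
    · exact div_nonneg (h.pos _).le (mul_pos hlam (h.pos _)).le
    · rfl
  set S := (Finset.univ.filter fun σ : Equiv.Perm (Fin k) => IsGridding M σ c r) with hS
  let W : Equiv.Perm (Fin k) → (Fin k → Fin u) × (Fin k → Fin t) :=
    fun σ => (fun p => row (σ p), fun v => col (σ.symm v))
  have hinj : Set.InjOn W S := fun σ hσ τ hτ hW => by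
    simp only [hS, Finset.coe_filter, Finset.mem_univ, true_and, Set.mem_ofPred_eq] at hσ hτ
    simp only [W, Prod.mk.injEq] at hW
    exact hσ.ext_of_words hcol hrow hτ (congrFun hW.1) (congrFun hW.2)
  -- A point in column `i` and row `j` contributes a factor to each of `P` and `Q`; the values of
  -- `f` cancel in their product, leaving `lam⁻²`.
  have hval : ∀ σ ∈ S, P (W σ).1 * Q (W σ).2 = ((lam ^ 2) ^ k)⁻¹ := by
    intro σ hσ
    simp only [hS, Finset.mem_filter, Finset.mem_univ, true_and] at hσ
    have hne : ∀ p, M (col p) (row (σ p)) ≠ 0 := fun p hp => by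
      have h1 := hσ.empty _ _ hp
      have h2 : p ∈ cell σ c r (col p) (row (σ p)) := by rw [cell_eq hcol hrow]; exact ⟨rfl, rfl⟩
      rw [h1] at h2
      exact h2
    have hQ' : Q (W σ).2 = ∏ p, f (.inl (col p)) / (lam * f (.inr (row (σ p)))) := by
      simp only [hQ, W]
      rw [← Equiv.prod_comp σ]
      exact Finset.prod_congr rfl fun p _ => by simp [hne p]
    have hP' : P (W σ).1 = ∏ p, f (.inr (row (σ p))) / (lam * f (.inl (col p))) :=
      Finset.prod_congr rfl fun p _ => by simp [W, hne p]
    rw [hP', hQ', ← Finset.prod_mul_distrib, ← inv_pow]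
    rw [Finset.prod_congr rfl (g := fun _ => (lam ^ 2)⁻¹) fun p _ => ?_]
    · simp
    · have := (h.pos (.inl (col p))).ne'
      have := (h.pos (.inr (row (σ p)))).ne'
      field_simp
  have hSc : ({σ : Equiv.Perm (Fin k) | IsGridding M σ c r}).ncard = S.card := by
    rw [← Set.ncard_coe_finset]; simp [hS]
  have himage := Finset.sum_image (f := fun x : (Fin k → Fin u) × (Fin k → Fin t) => P x.1 * Q x.2) hinj
  clear_value P Q W S
  have hcard : (S.card : ℝ) * ((lam ^ 2) ^ k)⁻¹ ≤ 1 := by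
    calc (S.card : ℝ) * ((lam ^ 2) ^ k)⁻¹ = ∑ σ ∈ S, P (W σ).1 * Q (W σ).2 := by
          rw [Finset.sum_congr rfl hval]; simp
      _ = ∑ x ∈ S.image W, P x.1 * Q x.2 := himage.symm
      _ ≤ ∑ x : (Fin k → Fin u) × (Fin k → Fin t), P x.1 * Q x.2 :=
          Finset.sum_le_sum_of_subset_of_nonneg (Finset.subset_univ _)
            fun x _ _ => mul_nonneg (hP0 _) (hQ0 _)
      _ = 1 := by
          rw [Fintype.sum_prod_type]
          simp only [← Finset.mul_sum, hQsum, mul_one, hPsum]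
  rw [hSc]
  have hl : 0 < (lam ^ 2) ^ k := by positivity
  rwa [← div_eq_mul_inv, div_le_one hl] at hcard

/-- All dividers lie in `{0, ..., k}`; the resulting polynomial factor disappears in the growth
rate. -/
theorem ncard_grid_le {lam : ℝ} {f : Fin t ⊕ Fin u → ℝ}
    (h : IsPerron (rowColumnGraph M) lam f) (hlam : 0 < lam) :
    ((Grid M k).ncard : ℝ) ≤ (k + 1) ^ (t + 1 + (u + 1)) * (lam ^ 2) ^ k := by
  classical
  let D := (Fin (t + 1) → Fin (k + 1)) × (Fin (u + 1) → Fin (k + 1))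
  have hsub : Grid M k ⊆ ⋃ d ∈ (Finset.univ : Finset D),
      {σ : Equiv.Perm (Fin k) | IsGridding M σ (fun i => (d.1 i : ℕ)) (fun j => (d.2 j : ℕ))} := by
    rintro σ ⟨c, r, hσ⟩
    simp only [Finset.mem_univ, Set.iUnion_true, Set.mem_iUnion]
    refine ⟨(fun i => ⟨c i, ?_⟩, fun j => ⟨r j, ?_⟩), hσ⟩
    · exact Nat.lt_succ_of_le (hσ.col_last ▸ hσ.col_mono (Fin.le_last _))
    · exact Nat.lt_succ_of_le (hσ.row_last ▸ hσ.row_mono (Fin.le_last _))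
  have h1 : (Grid M k).ncard ≤ ∑ d : D,
      {σ : Equiv.Perm (Fin k) |
        IsGridding M σ (fun i => (d.1 i : ℕ)) (fun j => (d.2 j : ℕ))}.ncard :=
    (Set.ncard_le_ncard hsub (Set.toFinite _)).trans (Finset.set_ncard_biUnion_le _ _)
  calc ((Grid M k).ncard : ℝ) ≤ ∑ d : D, (lam ^ 2) ^ k := by
        refine (Nat.cast_le.2 h1).trans ?_
        rw [Nat.cast_sum]
        exact Finset.sum_le_sum fun d _ => ncard_gridded_le h hlam _ _
    _ = _ := by simp [D, pow_add]

end Upper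

/-! ### Lower bound by multinomial coefficients -/

section Lower

open Nat in
/-- The number of words in which, for every `i`, the letter `j` occurs `a i j` times at the
positions `p` with `col p = i` is at least a product of multinomial coefficients. -/
theorem prod_factorial_le_card_words {α ι κ : Type*} [Fintype α] [Fintype ι] [Fintype κ]
    [DecidableEq α] [DecidableEq ι] [DecidableEq κ] (col : α → ι) (a : ι → κ → ℕ)
    (h : ∀ i, Nat.card {p // col p = i} = ∑ j, a i j) :
    ∏ i, (∑ j, a i j)! ≤
      (∏ x : ι × κ, (a x.1 x.2)!) *
        Nat.card {w : α → κ // ∀ x : ι × κ, Nat.card {p // (col p, w p) = x} = a x.1 x.2} := by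
  classical
  -- Such a labelling supplies one word `w₀` with the prescribed letter counts.
  have hE : ∃ E : α ≃ (Σ i, Σ j, Fin (a i j)), ∀ p, (E p).1 = col p := by
    have e : ∀ i, Nonempty ({p // col p = i} ≃ {s : Σ i, Σ j, Fin (a i j) // s.1 = i}) :=
      fun i => by
        refine ⟨Fintype.equivOfCardEq ?_⟩
        rw [← Nat.card_eq_fintype_card, ← Nat.card_eq_fintype_card, h,
          Nat.card_congr (Equiv.sigmaSubtype i)]
        simp
    exact ⟨Equiv.ofFiberEquiv fun i => (e i).some, fun p => Equiv.ofFiberEquiv_map _ p⟩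
  obtain ⟨E, hE⟩ := hE
  set w₀ : α → κ := fun p => (E p).2.1 with hw₀
  have hcard : ∀ x : ι × κ, Nat.card {p // (col p, w₀ p) = x} = a x.1 x.2 := by
    rintro ⟨i, j⟩
    have e1 : {p // (col p, w₀ p) = (i, j)} ≃
        {s : Σ i, Σ j, Fin (a i j) // (s.1, s.2.1) = (i, j)} :=
      E.subtypeEquiv fun p => by simp [hw₀, hE]
    rw [Nat.card_congr e1, ← Nat.card_fin (a i j)]
    refine (Nat.card_congr (Equiv.ofBijective (fun n => ⟨⟨i, j, n⟩, rfl⟩) ⟨?_, ?_⟩)).symm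
    · intro n n' hn
      simpa using hn
    · rintro ⟨⟨i', j', n⟩, hx⟩
      simp only [Prod.mk.injEq] at hx
      obtain ⟨rfl, rfl⟩ := hx
      exact ⟨n, rfl⟩
  set F : α → ι × κ := fun p => (col p, w₀ p) with hF
  have c1 : (Finset.univ.filter fun π : Equiv.Perm α => col ∘ π = col).card =
      ∏ i, (∑ j, a i j)! := by
    rw [← Fintype.card_subtype, DomMulAct.stabilizer_card]
    exact Finset.prod_congr rfl fun i _ => by rw [← h, Nat.card_eq_fintype_card]
  have c2 : (Finset.univ.filter fun π : Equiv.Perm α => F ∘ π = F).card =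
      ∏ x : ι × κ, (a x.1 x.2)! := by
    rw [← Fintype.card_subtype, DomMulAct.stabilizer_card]
    exact Finset.prod_congr rfl fun i _ => by rw [← hcard, Nat.card_eq_fintype_card]
  rw [← c1, ← c2]
  -- Orbit counting: the permutations preserving `col` act on `w₀`. Each word arises from at most as
  -- many of them as the stabiliser of `(col, w₀)` has elements, and all words obtained have the
  -- right letter counts.
  refine (Finset.card_le_mul_card_image (f := fun π : Equiv.Perm α => w₀ ∘ π) _ _
    (fun w hw => ?_)).trans (Nat.mul_le_mul_left _ ?_)
  · obtain ⟨π₀, hπ₀, rfl⟩ := Finset.mem_image.1 hw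
    refine Finset.card_le_card_of_injOn (fun π => π * π₀⁻¹) (fun π hπ => ?_)
      (fun π _ π' _ hh => mul_right_cancel hh)
    simp only [Finset.coe_filter, Finset.mem_univ, true_and, Finset.mem_filter,
      Set.mem_ofPred_eq] at hπ hπ₀ ⊢
    funext p
    have h1 := congrFun hπ.1 (π₀.symm p)
    have h2 := congrFun hπ.2 (π₀.symm p)
    have h3 := congrFun hπ₀ (π₀.symm p)
    simp only [Function.comp_apply, Equiv.apply_symm_apply] at h1 h2 h3
    simp [hF, h1, h2, h3]
  · rw [Nat.card_eq_fintype_card, Fintype.card_subtype]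
    refine Finset.card_le_card fun w hw => ?_
    obtain ⟨π, hπ, rfl⟩ := Finset.mem_image.1 hw
    simp only [Finset.mem_filter, Finset.mem_univ, true_and] at hπ ⊢
    intro x
    rw [← hcard x]
    refine Nat.card_congr (π.subtypeEquiv fun p => ?_)
    have := congrFun hπ p
    simp only [Function.comp_apply] at this
    simp [this]

/-- Two colourings of `Fin k` with the same numbers of elements of each colour are related by a
permutation which is monotone or antitone, as prescribed, on each colour class. -/
theorem exists_perm_of_card_fibers {k : ℕ} {ι : Type*} (F G : Fin k → ι)
    (h : ∀ x, Nat.card {p // F p = x} = Nat.card {p // G p = x}) (s : ι → SignType) :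
    ∃ σ : Equiv.Perm (Fin k), (∀ p, G (σ p) = F p) ∧
      (∀ x, s x = 1 → StrictMonoOn σ {p | F p = x}) ∧
      (∀ x, s x = -1 → StrictAntiOn σ {p | F p = x}) := by
  classical
  have he : ∀ x, ∃ e : {p // F p = x} ≃ {p // G p = x},
      (s x = 1 → StrictMono e) ∧ (s x = -1 → StrictAnti e) := by
    intro x
    have hx := h x
    simp only [Nat.card_eq_fintype_card] at hx
    let eF := Fintype.orderIsoFinOfCardEq {p // F p = x} hx
    let eG := Fintype.orderIsoFinOfCardEq {p // G p = x} rfl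
    by_cases hs : s x = 1
    · exact ⟨(eF.symm.trans eG).toEquiv, fun _ => (eF.symm.trans eG).strictMono,
        fun h' => by rw [hs] at h'; exact absurd h' (by decide)⟩
    -- The reversing bijection also serves for sign `0`, where nothing is required.
    · refine ⟨(eF.symm.toEquiv.trans Fin.revPerm).trans eG.toEquiv, fun h' => absurd h' hs,
        fun _ p q hpq => ?_⟩
      refine eG.strictMono ?_
      exact Fin.rev_lt_rev.2 (eF.symm.strictMono hpq)
  choose e he1 he2 using he
  have hval : ∀ p x (hx : F p = x), (Equiv.ofFiberEquiv e p : Fin k) = (e x ⟨p, hx⟩ : Fin k) := by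
    rintro p x rfl; rfl
  refine ⟨Equiv.ofFiberEquiv e, Equiv.ofFiberEquiv_map e, fun x hx p hp q hq hpq => ?_,
    fun x hx p hp q hq hpq => ?_⟩
  · rw [hval p x hp, hval q x hq]
    exact he1 x hx (show (⟨p, hp⟩ : {p // F p = x}) < ⟨q, hq⟩ from hpq)
  · rw [hval p x hp, hval q x hq]
    exact he2 x hx (show (⟨p, hp⟩ : {p // F p = x}) < ⟨q, hq⟩ from hpq)

open Nat in
/-- The number of gridded permutations with `a i j` points in cell `(i, j)` is at least a product
of multinomial coefficients, one for each column and each row. -/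
theorem prod_factorial_le_ncard_grid {t u k : ℕ} {M : Matrix (Fin t) (Fin u) SignType}
    (a : Fin t → Fin u → ℕ) (ha : ∀ i j, M i j = 0 → a i j = 0) (hk : ∑ i, ∑ j, a i j = k) :
    (∏ i, (∑ j, a i j)!) * (∏ j, (∑ i, a i j)!) ≤
      (∏ i, ∏ j, (a i j)!) ^ 2 * (Grid M k).ncard := by
  classical
  obtain ⟨c, c1, c2, c3, col, hcol, hcolc⟩ := exists_dividers (fun i => ∑ j, a i j) hk
  obtain ⟨r, r1, r2, r3, row, hrow, hrowc⟩ :=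
    exists_dividers (k := k) (fun j => ∑ i, a i j) (by rw [Finset.sum_comm]; exact hk)
  have hW := prod_factorial_le_card_words col a hcolc
  have hZ := prod_factorial_le_card_words row (fun j i => a i j) hrowc
  set W := {w : Fin k → Fin u // ∀ x : Fin t × Fin u, Nat.card {p // (col p, w p) = x} = a x.1 x.2}
  set Z := {z : Fin k → Fin t // ∀ x : Fin u × Fin t, Nat.card {p // (row p, z p) = x} = a x.2 x.1}
  have hσ : ∀ d : W × Z, ∃ σ ∈ Grid M k,
      (∀ p, row (σ p) = d.1.1 p) ∧ ∀ p, d.2.1 (σ p) = col p := by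
    rintro ⟨⟨w, hw⟩, ⟨z, hz⟩⟩
    -- The words may be chosen independently: `w` selects the positions of cell `(i, j)`, `z`
    -- selects its values, and there are `a i j` of each, to be matched in the direction given by
    -- `M`.
    obtain ⟨σ, h1, h2, h3⟩ := exists_perm_of_card_fibers (fun p => (col p, w p))
      (fun v => (z v, row v)) (fun x => by
        refine (hw x).trans ((hz x.swap).symm.trans ?_)
        exact Nat.card_congr (Equiv.subtypeEquivRight fun v => by
          rcases x with ⟨i, j⟩; simp [and_comm])) (fun x => M x.1 x.2)
    have h4 : ∀ p, z (σ p) = col p ∧ row (σ p) = w p := fun p => by simpa using h1 p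
    have hcell : ∀ i j, cell σ c r i j = {p | (col p, w p) = (i, j)} := fun i j => by
      rw [cell_eq hcol hrow]; ext p; simp [(h4 p).2]
    refine ⟨σ, ⟨c, r, c1, c2, c3, r1, r2, r3, fun i j hM => ?_, fun i j hM => ?_,
      fun i j hM => ?_⟩, fun p => (h4 p).2, fun p => (h4 p).1⟩
    · rw [hcell]; exact h2 (i, j) hM
    · rw [hcell]; exact h3 (i, j) hM
    · rw [hcell, Set.eq_empty_iff_forall_notMem]
      intro p hp
      have h5 := hw (i, j)
      rw [ha i j hM, Nat.card_eq_zero] at h5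
      rcases h5 with h5 | h5
      · exact h5.elim ⟨p, hp⟩
      · exact (not_finite_iff_infinite.2 h5) inferInstance
  choose σ hσ1 hσ2 hσ3 using hσ
  have hinj : Nat.card (W × Z) ≤ (Grid M k).ncard := by
    rw [← Nat.card_coe_set_eq]
    refine Nat.card_le_card_of_injective (fun d => (⟨σ d, hσ1 d⟩ : Grid M k)) fun d d' hd => ?_
    have hd : σ d = σ d' := congrArg Subtype.val hd
    refine Prod.ext (Subtype.ext (funext fun p => ?_)) (Subtype.ext (funext fun v => ?_))
    · rw [← hσ2, ← hσ2, hd]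
    · have e1 := hσ3 d ((σ d).symm v)
      have e2 := hσ3 d' ((σ d).symm v)
      rw [Equiv.apply_symm_apply] at e1
      rw [← hd, Equiv.apply_symm_apply] at e2
      rw [e1, e2]
  rw [Nat.card_prod] at hinj
  have e1 : ∏ x : Fin t × Fin u, (a x.1 x.2)! = ∏ i, ∏ j, (a i j)! := Fintype.prod_prod_type _
  have e2 : ∏ x : Fin u × Fin t, (a x.2 x.1)! = ∏ i, ∏ j, (a i j)! := by
    rw [Fintype.prod_prod_type, Finset.prod_comm]
  rw [e1] at hW
  rw [e2] at hZ
  calc _ ≤ _ := Nat.mul_le_mul hW hZ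
    _ = (∏ i, ∏ j, (a i j)!) ^ 2 * (Nat.card W * Nat.card Z) := by ring
    _ ≤ _ := Nat.mul_le_mul_left _ hinj

end Lower

/-! ### Asymptotics and the growth rate -/

section Growth

open Filter Topology

theorem tendsto_log_succ_div : Tendsto (fun k : ℕ => Real.log (k + 1) / k) atTop (𝓝 0) := by
  have h := (Real.tendsto_pow_log_div_mul_add_atTop 1 (-1) 1 one_ne_zero).comp
    (tendsto_atTop_add_const_right _ (1 : ℝ) tendsto_natCast_atTop_atTop)
  refine h.congr fun k => ?_
  simp

theorem mul_log_sub_le_log_factorial (x : ℕ) :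
    (x : ℝ) * Real.log x - x ≤ Real.log x.factorial := by
  induction x with
  | zero => simp
  | succ n ih =>
    rw [Nat.factorial_succ, Nat.cast_mul, Real.log_mul (by positivity) (by positivity)]
    push_cast
    rcases n.eq_zero_or_pos with rfl | hn
    · simp
    have hn : (0 : ℝ) < n := by exact_mod_cast hn
    have h1 : Real.log ((n + 1) / n) ≤ (n + 1) / n - 1 := Real.log_le_sub_one_of_pos (by positivity)
    rw [Real.log_div (by positivity) hn.ne'] at h1
    have h2 : ((n : ℝ) + 1) / n - 1 = 1 / n := by field_simp; ring
    rw [h2] at h1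
    have h3 : (n : ℝ) * (Real.log (n + 1) - Real.log n) ≤ 1 := by
      calc _ ≤ (n : ℝ) * (1 / n) := mul_le_mul_of_nonneg_left h1 hn.le
        _ = 1 := by field_simp
    linarith

theorem log_factorial_le (x : ℕ) :
    Real.log x.factorial ≤ (x : ℝ) * Real.log x - x + Real.log (x + 1) + 1 := by
  rcases x.eq_zero_or_pos with rfl | hx
  · simp
  have key : Real.log x.factorial ≤ (x : ℝ) * Real.log x - x + Real.log x + 1 := by
    induction x, hx using Nat.le_induction with
    | base => simp
    | succ n hn ih =>
      rw [Nat.factorial_succ, Nat.cast_mul, Real.log_mul (by positivity) (by positivity)]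
      push_cast
      have hn : (0 : ℝ) < n := by exact_mod_cast hn
      have h1 : Real.log (n / (n + 1)) ≤ n / (n + 1) - 1 :=
        Real.log_le_sub_one_of_pos (by positivity)
      rw [Real.log_div hn.ne' (by positivity)] at h1
      have h2 : (n : ℝ) / (n + 1) - 1 = -(1 / (n + 1)) := by field_simp; ring
      rw [h2] at h1
      have h3 : ((n : ℝ) + 1) * (Real.log n - Real.log (n + 1)) ≤ -1 := by
        calc _ ≤ ((n : ℝ) + 1) * -(1 / (n + 1)) := mul_le_mul_of_nonneg_left h1 (by positivity)
          _ = -1 := by field_simp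
      linarith
  have : Real.log x ≤ Real.log (x + 1) :=
    Real.log_le_log (by exact_mod_cast hx) (by linarith)
  linarith

/-- By the weak Stirling bounds `log a!` is `a * log a - a` up to `O(log k)`, so the numerator is
essentially `a * log (a / k)`. The correction terms are linear in `a`, so that they can cancel in
quotients of factorials. -/
theorem tendsto_log_factorial {a : ℕ → ℕ} {p : ℝ} (hle : ∀ k, a k ≤ k)
    (ha : Tendsto (fun k => (a k : ℝ) / k) atTop (𝓝 p)) :
    Tendsto (fun k => (Real.log (a k).factorial - a k * Real.log k + a k) / k) atTop
      (𝓝 (p * Real.log p)) := by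
  have h1 := (Real.continuous_mul_log.tendsto p).comp ha
  have h2 : Tendsto (fun k : ℕ => (Real.log (a k).factorial - (a k * Real.log (a k) - a k)) / k)
      atTop (𝓝 0) := by
    have h3 : Tendsto (fun k : ℕ => Real.log (k + 1) / k + 1 / k) atTop (𝓝 0) := by
      simpa using tendsto_log_succ_div.add tendsto_one_div_atTop_nhds_zero_nat
    refine squeeze_zero (fun k => ?_) (fun k => ?_) h3
    · have := mul_log_sub_le_log_factorial (a k)
      exact div_nonneg (by linarith) (Nat.cast_nonneg _)
    · rw [← add_div]
      refine div_le_div_of_nonneg_right ?_ (Nat.cast_nonneg _)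
      have h4 := log_factorial_le (a k)
      have h5 : Real.log ((a k : ℝ) + 1) ≤ Real.log (k + 1) :=
        Real.log_le_log (by positivity) (by have : (a k : ℝ) ≤ k := by exact_mod_cast hle k
                                            linarith)
      linarith
  have h3 := h2.add h1
  rw [zero_add] at h3
  refine h3.congr' ?_
  filter_upwards [eventually_gt_atTop 0] with k hk
  have hk : (0 : ℝ) < k := by exact_mod_cast hk
  simp only [Function.comp_apply]
  rcases (a k).eq_zero_or_pos with h0 | h0
  · simp [h0]
  have h0 : (0 : ℝ) < a k := by exact_mod_cast h0
  rw [Real.log_div h0.ne' hk.ne']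
  field_simp
  ring

variable {t u : ℕ}

/-- Any probability distribution on the cells is approximated by integer distributions. -/
theorem exists_rounding (p : Fin t → Fin u → ℝ) (hp : ∀ i j, 0 ≤ p i j) (hsum : ∑ i, ∑ j, p i j = 1)
    (i₀ : Fin t) (j₀ : Fin u) :
    ∃ a : ℕ → Fin t → Fin u → ℕ, (∀ k, ∑ i, ∑ j, a k i j = k) ∧
      (∀ k i j, p i j = 0 → (i, j) ≠ (i₀, j₀) → a k i j = 0) ∧
      ∀ i j, Tendsto (fun k => (a k i j : ℝ) / k) atTop (𝓝 (p i j)) := by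
  classical
  -- Round down everywhere and put the deficit, which is `o(k)`, into cell `(i₀, j₀)`; hence the
  -- exception for this cell in the support condition.
  set b : ℕ → Fin t → Fin u → ℕ := fun k i j => ⌊p i j * k⌋₊ with hb
  set s : ℕ → ℕ := fun k => ∑ i, ∑ j, b k i j with hs
  have hsk : ∀ k, s k ≤ k := fun k => by
    have : (s k : ℝ) ≤ k := by
      calc (s k : ℝ) = ∑ i, ∑ j, (b k i j : ℝ) := by simp [hs]
        _ ≤ ∑ i, ∑ j, p i j * k := Finset.sum_le_sum fun i _ => Finset.sum_le_sum fun j _ =>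
            Nat.floor_le (mul_nonneg (hp i j) (Nat.cast_nonneg _))
        _ = k := by simp only [← Finset.sum_mul, hsum, one_mul]
    exact_mod_cast this
  have hbt : ∀ i j, Tendsto (fun k => (b k i j : ℝ) / k) atTop (𝓝 (p i j)) := fun i j =>
    (tendsto_nat_floor_mul_div_atTop (hp i j)).comp tendsto_natCast_atTop_atTop
  have hst : Tendsto (fun k => (s k : ℝ) / k) atTop (𝓝 1) := by
    rw [← hsum]
    have : ∀ k, (s k : ℝ) / k = ∑ i, ∑ j, (b k i j : ℝ) / k := fun k => by
      simp [hs, Finset.sum_div]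
    simp only [this]
    exact tendsto_finsetSum _ fun i _ => tendsto_finsetSum _ fun j _ => hbt i j
  have hrt : Tendsto (fun k => ((k - s k : ℕ) : ℝ) / k) atTop (𝓝 0) := by
    have h1 := (tendsto_const_nhds (x := (1 : ℝ))).sub hst
    rw [sub_self] at h1
    refine h1.congr' ?_
    filter_upwards [eventually_gt_atTop 0] with k hk
    have hk : (k : ℝ) ≠ 0 := by exact_mod_cast hk.ne'
    rw [Nat.cast_sub (hsk k)]
    field_simp
  refine ⟨fun k i j => b k i j + if (i, j) = (i₀, j₀) then k - s k else 0, fun k => ?_,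
    fun k i j h0 hne => ?_, fun i j => ?_⟩
  · simp only [Finset.sum_add_distrib, Prod.mk.injEq]
    have : ∑ i, ∑ j, (if i = i₀ ∧ j = j₀ then k - s k else 0) = k - s k := by
      simp [ite_and]
    rw [this]
    exact Nat.add_sub_cancel' (hsk k)
  · simp [hb, h0, hne]
  · by_cases h : (i, j) = (i₀, j₀)
    · simpa [h, add_div] using (hbt i j).add hrt
    · simpa [h] using hbt i j

variable {M : Matrix (Fin t) (Fin u) SignType}

/-- Frequencies `p i j` proportional to `f i * f j` have marginals proportional to `lam * f i ^ 2`
and `lam * f j ^ 2`. So the product of the two marginals is `lam ^ 2 * p i j ^ 2` on every nonzero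
cell, and the multinomial lower bound has exponent `log (lam ^ 2)`, matching the upper bound. -/
theorem hasGrowthRate_grid {lam : ℝ} {f : Fin t ⊕ Fin u → ℝ}
    (h : IsPerron (rowColumnGraph M) lam f) {i₀ : Fin t} {j₀ : Fin u} (hM : M i₀ j₀ ≠ 0) :
    HasGrowthRate (Grid M) (lam ^ 2) := by
  classical
  have hlam : 0 < lam := h.lam_pos (rowColumnGraph_adj_inl_inr.2 hM)
  have hl2 : 0 < lam ^ 2 := by positivity
  -- the optimal distribution of the points
  set q : Fin t → Fin u → ℝ := fun i j => if M i j ≠ 0 then f (.inl i) * f (.inr j) else 0 with hq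
  set z := ∑ i, ∑ j, q i j with hz
  have hq0 : ∀ i j, 0 ≤ q i j := fun i j => by
    simp only [hq]; split_ifs
    exacts [(mul_pos (h.pos _) (h.pos _)).le, le_rfl]
  have hqi : ∀ i, ∑ j, q i j = lam * f (.inl i) ^ 2 := fun i => by
    have h1 := h.eq (.inl i)
    rw [nbrSum_rowColumnGraph_inl] at h1
    calc ∑ j, q i j = f (.inl i) * ∑ j, (if M i j ≠ 0 then f (.inr j) else 0) := by
          rw [Finset.mul_sum]; exact Finset.sum_congr rfl fun j _ => by simp only [hq, mul_ite, mul_zero]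
      _ = _ := by rw [h1]; ring
  have hqj : ∀ j, ∑ i, q i j = lam * f (.inr j) ^ 2 := fun j => by
    have h1 := h.eq (.inr j)
    rw [nbrSum_rowColumnGraph_inr] at h1
    calc ∑ i, q i j = f (.inr j) * ∑ i, (if M i j ≠ 0 then f (.inl i) else 0) := by
          rw [Finset.mul_sum]
          exact Finset.sum_congr rfl fun j _ => by
            simp only [hq, mul_ite, mul_zero]; rw [mul_comm]
      _ = _ := by rw [h1]; ring
  have hzpos : 0 < z := by
    rw [hz]
    simp only [hqi]
    exact Finset.sum_pos (fun i _ => mul_pos hlam (pow_pos (h.pos _) 2)) ⟨i₀, Finset.mem_univ _⟩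
  set p : Fin t → Fin u → ℝ := fun i j => q i j / z with hp
  have hp0 : ∀ i j, 0 ≤ p i j := fun i j => div_nonneg (hq0 i j) hzpos.le
  have hpsum : ∑ i, ∑ j, p i j = 1 := by
    simp only [hp, ← Finset.sum_div]
    exact div_self hzpos.ne'
  obtain ⟨a, ha1, ha2, ha3⟩ := exists_rounding p hp0 hpsum i₀ j₀
  have ha0 : ∀ k i j, M i j = 0 → a k i j = 0 := fun k i j hij => by
    refine ha2 k i j (by simp [hp, hq, hij]) fun he => ?_
    simp only [Prod.mk.injEq] at he
    rw [he.1, he.2] at hij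
    exact hM hij
  have hlow := fun k => prod_factorial_le_ncard_grid (a k) (ha0 k) (ha1 k)
  have hNpos : ∀ k, 0 < (Grid M k).ncard := fun k => by
    refine Nat.pos_of_ne_zero fun h0 => ?_
    have h1 := hlow k
    rw [h0, mul_zero] at h1
    have h2 : 0 < (∏ i, (∑ j, a k i j).factorial) * ∏ j, (∑ i, a k i j).factorial :=
      Nat.mul_pos (Finset.prod_pos fun _ _ => Nat.factorial_pos _)
        (Finset.prod_pos fun _ _ => Nat.factorial_pos _)
    omega
  -- lower bound
  set G : ℕ → ℕ → ℝ := fun k x => (Real.log x.factorial - x * Real.log k + x) / k with hG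
  -- The linear corrections in `G` cancel here: every point is counted once by columns, once by rows
  -- and twice negatively by cells.
  set S : ℕ → ℝ := fun k => ∑ i, G k (∑ j, a k i j) + ∑ j, G k (∑ i, a k i j)
    - 2 * ∑ i, ∑ j, G k (a k i j) with hS
  have hSle : ∀ k, S k ≤ Real.log (Grid M k).ncard / k := by
    intro k
    have h1 : (((∏ i, (∑ j, a k i j).factorial) * ∏ j, (∑ i, a k i j).factorial : ℕ) : ℝ) ≤
        (((∏ i, ∏ j, (a k i j).factorial) ^ 2 * (Grid M k).ncard : ℕ) : ℝ) :=
      Nat.cast_le.2 (hlow k)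
    have h2 := Real.log_le_log (Nat.cast_pos.2 (Nat.mul_pos
      (Finset.prod_pos fun _ _ => Nat.factorial_pos _)
      (Finset.prod_pos fun _ _ => Nat.factorial_pos _))) h1
    have hf : ∀ x : ℕ, (x.factorial : ℝ) ≠ 0 := fun x => by positivity
    push_cast at h2
    rw [Real.log_mul (Finset.prod_ne_zero_iff.2 fun _ _ => hf _)
      (Finset.prod_ne_zero_iff.2 fun _ _ => hf _),
      Real.log_mul (pow_ne_zero _ (Finset.prod_ne_zero_iff.2 fun _ _ =>
        Finset.prod_ne_zero_iff.2 fun _ _ => hf _)) (Nat.cast_ne_zero.2 (hNpos k).ne'),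
      Real.log_pow, Real.log_prod (fun _ _ => hf _), Real.log_prod (fun _ _ => hf _),
      Real.log_prod (fun _ _ => Finset.prod_ne_zero_iff.2 fun _ _ => hf _)] at h2
    have h3 : ∀ i, Real.log (∏ j, ((a k i j).factorial : ℝ)) =
        ∑ j, Real.log (a k i j).factorial := fun i => Real.log_prod fun _ _ => hf _
    simp only [h3] at h2
    have h4 : S k = (∑ i, Real.log (∑ j, a k i j).factorial
        + ∑ j, Real.log (∑ i, a k i j).factorial
        - 2 * ∑ i, ∑ j, Real.log (a k i j).factorial) / k := by
      have h5 : ∑ j, ∑ i, (a k i j : ℝ) = ∑ i, ∑ j, (a k i j : ℝ) := Finset.sum_comm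
      simp only [hS, hG, ← Finset.sum_div, Finset.sum_add_distrib, Finset.sum_sub_distrib,
        ← Finset.sum_mul, Nat.cast_sum, h5]
      ring
    rw [h4]
    refine div_le_div_of_nonneg_right ?_ (Nat.cast_nonneg _)
    push_cast at h2
    linarith
  have hile : ∀ k i, ∑ j, a k i j ≤ k := fun k i => by
    conv_rhs => rw [← ha1 k]
    exact Finset.single_le_sum (f := fun i => ∑ j, a k i j) (fun _ _ => Nat.zero_le _)
      (Finset.mem_univ i)
  have hijle : ∀ k i j, a k i j ≤ k := fun k i j =>
    (Finset.single_le_sum (f := fun j => a k i j) (fun _ _ => Nat.zero_le _)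
      (Finset.mem_univ j)).trans (hile k i)
  have hjle : ∀ k j, ∑ i, a k i j ≤ k := fun k j => by
    conv_rhs => rw [← ha1 k, Finset.sum_comm]
    exact Finset.single_le_sum (f := fun j => ∑ i, a k i j) (fun _ _ => Nat.zero_le _)
      (Finset.mem_univ j)
  have hSlim : Tendsto S atTop (𝓝 (∑ i, (∑ j, p i j) * Real.log (∑ j, p i j)
      + ∑ j, (∑ i, p i j) * Real.log (∑ i, p i j) - 2 * ∑ i, ∑ j, p i j * Real.log (p i j))) := by
    refine ((tendsto_finsetSum _ fun i _ => ?_).add (tendsto_finsetSum _ fun j _ => ?_)).sub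
      ((tendsto_finsetSum _ fun i _ => tendsto_finsetSum _ fun j _ => ?_).const_mul 2)
    · refine tendsto_log_factorial (fun k => hile k i) ?_
      simp only [Nat.cast_sum, Finset.sum_div]
      exact tendsto_finsetSum _ fun j _ => ha3 i j
    · refine tendsto_log_factorial (fun k => hjle k j) ?_
      simp only [Nat.cast_sum, Finset.sum_div]
      exact tendsto_finsetSum _ fun i _ => ha3 i j
    · exact tendsto_log_factorial (fun k => hijle k i j) (ha3 i j)
  have hval : ∑ i, (∑ j, p i j) * Real.log (∑ j, p i j)
      + ∑ j, (∑ i, p i j) * Real.log (∑ i, p i j) - 2 * ∑ i, ∑ j, p i j * Real.log (p i j)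
      = Real.log (lam ^ 2) := by
    have e1 : ∑ j, (∑ i, p i j) * Real.log (∑ i, p i j) =
        ∑ i, ∑ j, p i j * Real.log (∑ i, p i j) := by
      simp only [Finset.sum_mul]
      exact Finset.sum_comm
    rw [e1]
    simp only [Finset.sum_mul, Finset.mul_sum, ← Finset.sum_add_distrib, ← Finset.sum_sub_distrib]
    rw [← one_mul (Real.log (lam ^ 2)), ← hpsum]
    simp only [Finset.sum_mul]
    refine Finset.sum_congr rfl fun i _ => Finset.sum_congr rfl fun j _ => ?_
    by_cases hij : M i j = 0
    · have : p i j = 0 := by simp [hp, hq, hij]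
      simp [this]
    have e2 : ∑ j, p i j = lam * f (.inl i) ^ 2 / z := by
      simp only [hp, ← Finset.sum_div, hqi]
    have e3 : ∑ i, p i j = lam * f (.inr j) ^ 2 / z := by
      simp only [hp, ← Finset.sum_div, hqj]
    have e4 : p i j = f (.inl i) * f (.inr j) / z := by simp [hp, hq, hij]
    have hfi := (h.pos (.inl i)).ne'
    have hfj := (h.pos (.inr j)).ne'
    rw [e2, e3]
    have e5 : Real.log (lam * f (.inl i) ^ 2 / z) + Real.log (lam * f (.inr j) ^ 2 / z)
        - 2 * Real.log (p i j) = Real.log (lam ^ 2) := by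
      rw [e4, Real.log_div (mul_ne_zero hlam.ne' (pow_ne_zero _ hfi)) hzpos.ne',
        Real.log_div (mul_ne_zero hlam.ne' (pow_ne_zero _ hfj)) hzpos.ne',
        Real.log_div (mul_ne_zero hfi hfj) hzpos.ne', Real.log_mul hlam.ne' (pow_ne_zero _ hfi),
        Real.log_mul hlam.ne' (pow_ne_zero _ hfj), Real.log_mul hfi hfj]
      simp only [Real.log_pow]
      push_cast
      ring
    rw [← e5]
    ring
  rw [hval] at hSlim
  -- upper bound
  have hup : ∀ᶠ k : ℕ in atTop, Real.log (Grid M k).ncard / k ≤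
      (t + 1 + (u + 1) : ℕ) * (Real.log (k + 1) / k) + Real.log (lam ^ 2) := by
    filter_upwards [eventually_gt_atTop 0] with k hk
    have hk : (0 : ℝ) < k := by exact_mod_cast hk
    have h1 := Real.log_le_log (Nat.cast_pos.2 (hNpos k)) (ncard_grid_le (k := k) h hlam)
    rw [Real.log_mul (by positivity) (by positivity), Real.log_pow, Real.log_pow] at h1
    rw [div_le_iff₀ hk]
    calc _ ≤ _ := h1
      _ = _ := by field_simp
  have hlim : Tendsto (fun k : ℕ => Real.log (Grid M k).ncard / k) atTop
      (𝓝 (Real.log (lam ^ 2))) := by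
    refine tendsto_of_tendsto_of_tendsto_of_le_of_le' hSlim ?_ (Eventually.of_forall hSle) hup
    simpa using (tendsto_log_succ_div.const_mul ((t + 1 + (u + 1) : ℕ) : ℝ)).add_const _
  have h1 := (Real.continuous_exp.tendsto _).comp hlim
  rw [Real.exp_log hl2] at h1
  refine h1.congr fun k => ?_
  simp only [Function.comp_apply]
  rw [Real.rpow_def_of_pos (Nat.cast_pos.2 (hNpos k)), mul_one_div]

end Growth

/-! ### Paths through vertices of degree two -/

section Ends

variable {V : Type*}

/-- The path which starts with the dart from `y` to `x` and continues through vertices of degree two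
ends in a vertex whose remaining neighbours form the set `L` and are leaves. -/
inductive TreeEnd (G : SimpleGraph V) (L : Set V) : V → V → Prop
  | base {y x : V} : y ∉ L → (∀ z, G.Adj x z ↔ z = y ∨ z ∈ L) →
      (∀ u ∈ L, ∀ z, G.Adj u z ↔ z = x) → TreeEnd G L y x
  | step {y x c : V} : c ≠ y → (∀ z, G.Adj x z ↔ z = y ∨ z = c) → TreeEnd G L x c → TreeEnd G L y x

/-- The path which starts with the dart from `y` to `x` and continues through vertices of degree two
ends in a vertex of degree at least three. -/
inductive BranchEnd (G : SimpleGraph V) : V → V → Prop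
  | base {y x u v : V} : G.Adj x y → G.Adj x u → G.Adj x v → u ≠ y → v ≠ y → u ≠ v →
      BranchEnd G y x
  | step {y x c : V} : c ≠ y → (∀ z, G.Adj x z ↔ z = y ∨ z = c) → BranchEnd G x c → BranchEnd G y x

/-- The vertices `r 0, ..., r (m + 1)` form a path whose inner vertices have degree two and whose
first vertex has, besides `r 1`, the neighbours in `L`, which are leaves. -/
structure IsChain (G : SimpleGraph V) (L : Set V) (r : ℕ → V) (m : ℕ) : Prop where
  inj : ∀ i ≤ m + 1, ∀ j ≤ m + 1, r i = r j → i = j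
  first : ∀ z, G.Adj (r 0) z ↔ z = r 1 ∨ z ∈ L
  notMem : r 1 ∉ L
  mid : ∀ i < m, ∀ z, G.Adj (r (i + 1)) z ↔ z = r i ∨ z = r (i + 2)
  leaf : ∀ u ∈ L, ∀ z, G.Adj u z ↔ z = r 0

variable {G : SimpleGraph V} {L : Set V} {r : ℕ → V} {m : ℕ}

theorem IsChain.adj_succ (h : IsChain G L r m) {i : ℕ} (hi : i ≤ m) : G.Adj (r i) (r (i + 1)) := by
  rcases i with _ | i
  · exact (h.first _).2 (Or.inl rfl)
  · exact (h.mid i (by omega) _).2 (Or.inr rfl)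

theorem IsChain.apply_notMem (h : IsChain G L r m) {i : ℕ} (hi : i ≤ m + 1) : r i ∉ L := by
  intro hL
  have hl := h.leaf _ hL
  rcases i with _ | i
  · exact G.irrefl ((hl _).2 rfl)
  · have h1 : r i = r 0 := (hl _).1 (h.adj_succ (by omega)).symm
    have h2 := h.inj i (by omega) 0 (by omega) h1
    subst h2
    exact h.notMem hL

theorem IsChain.adj_iff (h : IsChain G L r m) {i j : ℕ} (hi : i ≤ m + 1) (hj : j ≤ m + 1) :
    G.Adj (r i) (r j) ↔ i + 1 = j ∨ j + 1 = i := by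
  have key : ∀ i j, i ≤ m → j ≤ m + 1 → (G.Adj (r i) (r j) ↔ i + 1 = j ∨ j + 1 = i) := by
    intro i j hi hj
    refine ⟨fun hadj => ?_, ?_⟩
    · rcases i with _ | i
      · rcases (h.first _).1 hadj with h1 | h1
        · have := h.inj j hj 1 (by omega) h1
          omega
        · exact absurd h1 (h.apply_notMem hj)
      · rcases (h.mid i (by omega) _).1 hadj with h1 | h1
        · have := h.inj j hj i (by omega) h1
          omega
        · have := h.inj j hj (i + 2) (by omega) h1
          omega
    · rintro (rfl | rfl)
      · exact h.adj_succ hi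
      · exact (h.adj_succ (by omega)).symm
  rcases Nat.lt_or_ge m i with h1 | h1
  · rcases Nat.lt_or_ge m j with h2 | h2
    · have : i = j := by omega
      subst this
      simp
    · rw [G.adj_comm, key j i h2 hi, or_comm]
  · exact key i j h1 hj

theorem IsChain.extend (h : IsChain G L r m) {c : V} (hc : c ≠ r m)
    (hN : ∀ z, G.Adj (r (m + 1)) z ↔ z = r m ∨ z = c) :
    IsChain G L (fun i => if i ≤ m + 1 then r i else c) (m + 1) := by
  -- The chain cannot close up: the only chain vertex adjacent to `r (m + 1)` is `r m`.
  have hcr : ∀ i ≤ m + 1, c ≠ r i := by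
    rintro i hi rfl
    have h1 : G.Adj (r (m + 1)) (r i) := (hN _).2 (Or.inr rfl)
    rw [h.adj_iff le_rfl hi] at h1
    have : i = m := by omega
    exact hc (by rw [this])
  refine ⟨fun i hi j hj hij => ?_, ?_, ?_, fun i hi z => ?_, ?_⟩
  · by_cases h1 : i ≤ m + 1 <;> by_cases h2 : j ≤ m + 1 <;> simp only [h1, h2, if_true, if_false] at hij
    · exact h.inj i h1 j h2 hij
    · exact absurd hij.symm (hcr i h1)
    · exact absurd hij (hcr j h2)
    · omega
  · simpa using h.first
  · simpa using h.notMem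
  · rcases Nat.lt_or_ge i m with h1 | h1
    · have e1 : i + 1 ≤ m + 1 := by omega
      have e2 : i + 2 ≤ m + 1 := by omega
      have e3 : i ≤ m + 1 := by omega
      simpa only [e1, e2, e3, if_true] using h.mid i h1 z
    · have : i = m := by omega
      subst this
      simpa using hN z
  · simpa using h.leaf

/-- The chain is numbered from the far end, so that each induction step appends the new `y` as last
vertex. -/
theorem TreeEnd.exists_isChain {y x : V} (h : TreeEnd G L y x) :
    ∃ r m, IsChain G L r m ∧ r m = x ∧ r (m + 1) = y := by
  induction h with
  | @base y x hy hx hL =>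
    have hxy : x ≠ y := by rintro rfl; exact G.irrefl ((hx x).2 (Or.inl rfl))
    refine ⟨fun i => if i = 0 then x else y, 0, ⟨fun i hi j hj hij => ?_, ?_, ?_, ?_, ?_⟩, ?_, ?_⟩
    · by_cases h1 : i = 0 <;> by_cases h2 : j = 0 <;> simp only [h1, h2, if_true, if_false] at hij
      · omega
      · exact absurd hij hxy
      · exact absurd hij.symm hxy
      · omega
    · simpa using hx
    · simpa using hy
    · intro i hi; omega
    · simpa using hL
    · simp
    · simp
  | @step y x c hc hx _ ih =>
    obtain ⟨r, m, hr, h1, h2⟩ := ih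
    refine ⟨_, _, hr.extend (c := y) (by rw [h1]; exact hc.symm) fun z => ?_, ?_, ?_⟩
    · rw [h1, h2, hx, or_comm]
    · simp [h2]
    · simp

/-- Two leaf sets at the ends of a path. -/
theorem TreeEnd.exists_isChain_isLast {L' : Set V} {y x : V} (h : TreeEnd G L' y x) :
    ∀ r m, IsChain G L r m → r m = y → r (m + 1) = x →
      ∃ r m, IsChain G L r m ∧ r m ∉ L' ∧ (∀ z, G.Adj (r (m + 1)) z ↔ z = r m ∨ z ∈ L') ∧
        ∀ u ∈ L', ∀ z, G.Adj u z ↔ z = r (m + 1) := by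
  induction h with
  | base hy hx hL =>
    rintro r m hr rfl rfl
    exact ⟨r, m, hr, hy, hx, hL⟩
  | @step y x c hc hx _ ih =>
    rintro r m hr rfl rfl
    exact ih _ _ (hr.extend hc hx) (by simp) (by simp)

/-- Once the edge is deleted, `r 0, ..., r m` is closed under adjacency. It is therefore the
component of `x = r m`, and it misses `y = r (m + 1)`. -/
theorem TreeEnd.liesOnEndpath {y x : V} (h : TreeEnd G ∅ y x) : LiesOnEndpath G s(y, x) := by
  obtain ⟨r, m, hr, rfl, rfl⟩ := h.exists_isChain
  set H := G.deleteEdges {s(r (m + 1), r m)} with hH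
  have hadj : ∀ i ≤ m, ∀ z, H.Adj (r i) z ↔ ∃ j ≤ m, z = r j ∧ (i + 1 = j ∨ j + 1 = i) := by
    intro i hi z
    rw [hH, SimpleGraph.deleteEdges_adj]
    constructor
    · rintro ⟨h1, h2⟩
      have hz : ∃ j ≤ m + 1, z = r j := by
        rcases i with _ | i
        · rcases (hr.first z).1 h1 with h3 | h3
          · exact ⟨1, by omega, h3⟩
          · exact h3.elim
        · rcases (hr.mid i (by omega) z).1 h1 with h3 | h3
          · exact ⟨i, by omega, h3⟩
          · exact ⟨i + 2, by omega, h3⟩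
      obtain ⟨j, hj, rfl⟩ := hz
      rw [hr.adj_iff (by omega) hj] at h1
      refine ⟨j, ?_, rfl, h1⟩
      by_contra hj'
      have e1 : j = m + 1 := by omega
      have e2 : i = m := by omega
      subst e1 e2
      exact h2 Sym2.eq_swap
    · rintro ⟨j, hj, rfl, hij⟩
      refine ⟨(hr.adj_iff (by omega) (by omega)).2 hij, fun h2 => ?_⟩
      have h2 : s(r i, r j) = s(r (m + 1), r m) := h2
      rw [Sym2.eq_iff] at h2
      rcases h2 with ⟨h2, -⟩ | ⟨-, h2⟩
      · have := hr.inj i (by omega) (m + 1) le_rfl h2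
        omega
      · have := hr.inj j (by omega) (m + 1) le_rfl h2
        omega
  have hreach : ∀ i ≤ m, H.Reachable (r i) (r m) := by
    intro i hi
    induction hi using Nat.decreasingInduction with
    | self => exact SimpleGraph.Reachable.refl _
    | of_succ i hi ih =>
      exact ((hadj i (by omega) _).2 ⟨i + 1, hi, rfl, Or.inl rfl⟩).reachable.trans ih
  have hclosed : ∀ z, H.Reachable (r m) z → ∃ i ≤ m, z = r i := by
    rintro z ⟨p⟩
    have : ∀ {a b : V} (_ : H.Walk a b), (∃ i ≤ m, a = r i) → ∃ i ≤ m, b = r i := by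
      intro a b p
      induction p with
      | nil => exact id
      | cons hab _ ih =>
        rintro ⟨i, hi, rfl⟩
        obtain ⟨j, hj, rfl, -⟩ := (hadj i hi _).1 hab
        exact ih ⟨j, hj, rfl⟩
    exact this p ⟨m, le_rfl, rfl⟩
  refine ⟨fun hconn => ?_, r m, Sym2.mem_mk_right _ _, m, ?_⟩
  · obtain ⟨i, hi, h1⟩ := hclosed _ (hconn.preconnected (r m) (r (m + 1)))
    have := hr.inj (m + 1) le_rfl i (by omega) h1
    omega
  -- The numbering is reversed because the path has to start at the endvertex `r m` of the deleted
  -- edge.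
  · let φ : Fin (m + 1) → (H.connectedComponentMk (r m)) := fun i =>
      ⟨r (m - i), SimpleGraph.ConnectedComponent.sound (hreach (m - i) (by omega))⟩
    have hφ : Function.Bijective φ := by
      constructor
      · intro i j hij
        have := hr.inj _ (by omega) _ (by omega) (congrArg Subtype.val hij)
        ext
        omega
      · rintro ⟨z, hz⟩
        obtain ⟨i, hi, rfl⟩ := hclosed z (SimpleGraph.ConnectedComponent.exact hz).symm
        refine ⟨⟨m - i, by omega⟩, Subtype.ext ?_⟩
        simp only [φ]
        congr 1
        omega
    refine ⟨⟨Equiv.ofBijective φ hφ, ?_⟩, ?_⟩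
    · intro i j
      have : (H.connectedComponentMk (r m)).toSimpleGraph.Adj (φ i) (φ j) ↔
        H.Adj (r (m - i)) (r (m - j)) := Iff.rfl
      rw [Equiv.ofBijective_apply, Equiv.ofBijective_apply, this, hadj _ (by omega),
        SimpleGraph.pathGraph_adj]
      constructor
      · rintro ⟨l, hl, h1, h2⟩
        have := hr.inj _ (by omega) _ (by omega) h1
        omega
      · intro h1
        exact ⟨m - j, by omega, rfl, by omega⟩
    · change r (m - 0) = r m
      simp

/-- The two paths join, through the edge `a b`, to one chain with a pair of leaves at either end.
This set is closed under adjacency, hence everything. -/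
theorem isHGraph_of_treeEnd (hG : G.Connected) {a b u v u' v' : V} (huv : u ≠ v) (huv' : u' ≠ v')
    (h1 : TreeEnd G {u, v} a b) (h2 : TreeEnd G {u', v'} b a) : IsHGraph G := by
  obtain ⟨r₀, m₀, hr₀, e1, e2⟩ := h1.exists_isChain
  obtain ⟨r, m, hr, hnm, hlast, hleaf⟩ := h2.exists_isChain_isLast r₀ m₀ hr₀ e1 e2
  have hu := hr.leaf u (by simp)
  have hv := hr.leaf v (by simp)
  have hu' := hleaf u' (by simp)
  have hv' := hleaf v' (by simp)
  have hL : ∀ i ≤ m + 1, r i ≠ u ∧ r i ≠ v := fun i hi => by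
    have := hr.apply_notMem hi
    simpa using this
  have hL' : ∀ i ≤ m + 1, r i ∉ ({u', v'} : Set V) := fun i hi hi' => by
    have hl := hleaf _ hi'
    rcases Nat.lt_or_ge m i with h3 | h3
    · have : i = m + 1 := by omega
      subst this
      exact G.irrefl ((hl _).2 rfl)
    · have h4 := hr.inj _ (by omega) _ le_rfl ((hl _).1 (hr.adj_succ h3))
      have : i = m := by omega
      exact hnm (this ▸ hi')
  have hL' : ∀ i ≤ m + 1, r i ≠ u' ∧ r i ≠ v' := fun i hi => by simpa using hL' i hi
  have hdis : ∀ w w', (∀ z, G.Adj w z ↔ z = r 0) → (∀ z, G.Adj w' z ↔ z = r (m + 1)) → w ≠ w' := by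
    rintro w w' hw hw' rfl
    have := hr.inj 0 (by omega) (m + 1) le_rfl ((hw' _).1 ((hw _).2 rfl))
    omega
  let φ : Fin (m + 1 + 1) ⊕ (Bool × Bool) → V := fun x => match x with
    | .inl i => r i
    | .inr (false, false) => u
    | .inr (false, true) => v
    | .inr (true, false) => u'
    | .inr (true, true) => v'
  have hφ : Function.Bijective φ := by
    constructor
    · have k1 := hdis u u' hu hu'
      have k2 := hdis u v' hu hv'
      have k3 := hdis v u' hv hu'
      have k4 := hdis v v' hv hv'
      rintro (i | ⟨_ | _, _ | _⟩) (j | ⟨_ | _, _ | _⟩) hij <;> simp only [φ] at hij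
      · have := hr.inj _ (by omega) _ (by omega) hij
        rw [Fin.ext this]
      all_goals first
        | rfl
        | exact absurd hij (by assumption)
        | exact absurd hij.symm (by assumption)
        | exact absurd hij (hL i (by omega)).1
        | exact absurd hij (hL i (by omega)).2
        | exact absurd hij (hL' i (by omega)).1
        | exact absurd hij (hL' i (by omega)).2
        | exact absurd hij.symm (hL j (by omega)).1
        | exact absurd hij.symm (hL j (by omega)).2
        | exact absurd hij.symm (hL' j (by omega)).1
        | exact absurd hij.symm (hL' j (by omega)).2
    · have hr' : ∀ i ≤ m + 1, ∃ x, φ x = r i := fun i hi => ⟨.inl ⟨i, by omega⟩, rfl⟩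
      refine forall_of_connected hG (P := fun z => ∃ x, φ x = z) (hr' 0 (by omega)) ?_
      rintro _ z hz ⟨i | ⟨_ | _, _ | _⟩, rfl⟩
      · change G.Adj (r i) z at hz
        obtain ⟨i, hi⟩ := i
        rcases i with _ | i
        · rcases (hr.first z).1 hz with rfl | rfl | rfl
          · exact hr' 1 (by omega)
          · exact ⟨.inr (false, false), rfl⟩
          · exact ⟨.inr (false, true), rfl⟩
        · rcases Nat.lt_or_ge i m with h3 | h3
          · rcases (hr.mid i h3 z).1 hz with rfl | rfl
            · exact hr' _ (by omega)
            · exact hr' _ (by omega)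
          · have : i = m := by omega
            subst this
            rcases (hlast z).1 hz with rfl | rfl | rfl
            · exact hr' _ (by omega)
            · exact ⟨.inr (true, false), rfl⟩
            · exact ⟨.inr (true, true), rfl⟩
      · exact (hu z).1 hz ▸ hr' 0 (by omega)
      · exact (hv z).1 hz ▸ hr' 0 (by omega)
      · exact (hu' z).1 hz ▸ hr' _ le_rfl
      · exact (hv' z).1 hz ▸ hr' _ le_rfl
  refine ⟨m + 1, ⟨SimpleGraph.Iso.symm ⟨Equiv.ofBijective φ hφ, ?_⟩⟩⟩
  have g1 : ∀ w, (∀ z, G.Adj w z ↔ z = r 0) → ∀ i : Fin (m + 1 + 1), G.Adj w (r i) ↔ i = 0 := by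
    intro w hw i
    rw [hw]
    refine ⟨fun h => Fin.ext (hr.inj _ (by omega) _ (by omega) h), fun h => by rw [h]; rfl⟩
  have g2 : ∀ w, (∀ z, G.Adj w z ↔ z = r (m + 1)) → ∀ i : Fin (m + 1 + 1),
      G.Adj w (r i) ↔ i = Fin.last (m + 1) := by
    intro w hw i
    rw [hw]
    refine ⟨fun h => Fin.ext (hr.inj _ (by omega) _ (by omega) h), fun h => by rw [h]; rfl⟩
  have z0 : (0 : ℕ) ≤ m + 1 := by omega
  rintro (i | ⟨_ | _, _ | _⟩) (j | ⟨_ | _, _ | _⟩)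
  · change G.Adj (r i) (r j) ↔ (SimpleGraph.pathGraph _).Adj i j
    rw [hr.adj_iff (by omega) (by omega), SimpleGraph.pathGraph_adj]
  · exact (G.adj_comm _ _).trans (g1 u hu i)
  · exact (G.adj_comm _ _).trans (g1 v hv i)
  · exact (G.adj_comm _ _).trans (g2 u' hu' i)
  · exact (G.adj_comm _ _).trans (g2 v' hv' i)
  · exact g1 u hu j
  pick_goal 5
  · exact g1 v hv j
  pick_goal 9
  · exact g2 u' hu' j
  pick_goal 13
  · exact g2 v' hv' j
  -- What remains are pairs of pendant vertices: the only neighbour of each is an end of the chain,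
  -- and no chain vertex is pendant.
  all_goals
    refine iff_of_false (fun h => ?_) (fun h => h)
    simp only [Equiv.ofBijective_apply, φ, hu, hv, hu', hv'] at h
    first
      | exact (hL 0 z0).1 h.symm
      | exact (hL 0 z0).2 h.symm
      | exact (hL' 0 z0).1 h.symm
      | exact (hL' 0 z0).2 h.symm
      | exact (hL _ le_rfl).1 h.symm
      | exact (hL _ le_rfl).2 h.symm
      | exact (hL' _ le_rfl).1 h.symm
      | exact (hL' _ le_rfl).2 h.symm

end Ends

/-! ### Excluding cycles and eigenvalues at most two -/

section Classification

variable {V : Type*} [Fintype V] {G : SimpleGraph V}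

/-- A connected graph in which all degrees are two is a cycle. -/
theorem isCycleGraph_of_two_regular (hG : G.Connected)
    (h : ∀ v, ∃ a b, a ≠ b ∧ ∀ z, G.Adj v z ↔ z = a ∨ z = b) : IsCycleGraph G := by
  classical
  have hdeg : ∀ v, G.degree v = 2 := fun v => by
    obtain ⟨a, b, hab, hv⟩ := h v
    have : G.neighborFinset v = {a, b} := by ext z; simp [hv]
    rw [← SimpleGraph.card_neighborFinset_eq_degree, this, Finset.card_pair hab]
  have hna : ¬ G.IsAcyclic := fun hac => by
    have : Nontrivial V := by
      obtain ⟨v⟩ := hG.nonempty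
      obtain ⟨a, b, hab, -⟩ := h v
      exact ⟨a, b, hab⟩
    have h1 := (SimpleGraph.IsTree.mk hG hac).minDegree_eq_one_of_nontrivial
    obtain ⟨v, hv⟩ := G.exists_minimal_degree_vertex
    rw [hdeg] at hv
    omega
  rw [SimpleGraph.isAcyclic_iff_free_cycleGraph] at hna
  push Not at hna
  obtain ⟨n, hn, hcon⟩ := hna
  obtain ⟨φ⟩ := hcon
  obtain ⟨k, rfl⟩ : ∃ k, n = k + 3 := ⟨n - 3, by omega⟩
  have hinj : Function.Injective (φ : Fin (k + 3) → V) := φ.injective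
  -- A vertex of the embedded cycle already has both its neighbours on the cycle, so the cycle is
  -- all of `G` and has no chords.
  have hnbr : ∀ i z, G.Adj (φ i) z → ∃ j, φ j = z ∧ (SimpleGraph.cycleGraph (k + 3)).Adj i j := by
    intro i z hz
    have hsub : ((SimpleGraph.cycleGraph (k + 3)).neighborFinset i).image φ ⊆
        G.neighborFinset (φ i) := by
      intro w hw
      obtain ⟨j, hj, rfl⟩ := Finset.mem_image.1 hw
      rw [SimpleGraph.mem_neighborFinset] at hj ⊢
      exact φ.toHom.map_adj hj
    have heq := Finset.eq_of_subset_of_card_le hsub (by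
      rw [SimpleGraph.card_neighborFinset_eq_degree, hdeg,
        Finset.card_image_of_injective _ hinj, SimpleGraph.card_neighborFinset_eq_degree]
      exact SimpleGraph.cycleGraph_degree_three_le.ge)
    have hz' : z ∈ G.neighborFinset (φ i) := by simpa using hz
    rw [← heq] at hz'
    obtain ⟨j, hj, rfl⟩ := Finset.mem_image.1 hz'
    exact ⟨j, rfl, by simpa using hj⟩
  have hsurj : Function.Surjective φ := by
    refine forall_of_connected hG (P := fun z => ∃ i, φ i = z) ⟨0, rfl⟩ ?_
    rintro _ z hz ⟨i, rfl⟩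
    obtain ⟨j, hj, -⟩ := hnbr i z hz
    exact ⟨j, hj⟩
  refine ⟨k + 3, hn, ⟨SimpleGraph.Iso.symm
    ⟨Equiv.ofBijective φ ⟨hinj, hsurj⟩, fun {i j} => ⟨fun hij => ?_, fun hij => ?_⟩⟩⟩⟩
  · obtain ⟨l, hl, h1⟩ := hnbr i _ hij
    exact hinj hl ▸ h1
  · exact φ.toHom.map_adj hij

/-- A dart with neither kind of end has a unique continuation, which again has neither. Continuation
is injective on the finite set of such darts, hence bijective, so their heads are closed under
adjacency. Then all degrees are two and `G` is a cycle. -/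
theorem treeEnd_or_branchEnd (hG : G.Connected) (hcyc : ¬ IsCycleGraph G) {y x : V}
    (hxy : G.Adj x y) : TreeEnd G ∅ y x ∨ BranchEnd G y x := by
  by_contra hcon
  push Not at hcon
  let S := {d : V × V // G.Adj d.2 d.1 ∧ ¬ TreeEnd G ∅ d.1 d.2 ∧ ¬ BranchEnd G d.1 d.2}
  have hnext : ∀ d : S, ∃ d' : S, d'.1.1 = d.1.2 ∧ d'.1.2 ≠ d.1.1 ∧
      ∀ z, G.Adj d.1.2 z ↔ z = d.1.1 ∨ z = d'.1.2 := by
    rintro ⟨⟨y, x⟩, hadj, ht, hb⟩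
    simp only at hadj ht hb ⊢
    by_cases hc : ∃ c, c ≠ y ∧ G.Adj x c
    · obtain ⟨c, hcy, hxc⟩ := hc
      have hN : ∀ z, G.Adj x z ↔ z = y ∨ z = c := by
        refine fun z => ⟨fun hz => ?_, ?_⟩
        · by_contra! hne
          exact hb (.base hadj hz hxc hne.1 hcy hne.2)
        · rintro (rfl | rfl) <;> assumption
      exact ⟨⟨(x, c), hxc.symm, fun h => ht (.step hcy hN h), fun h => hb (.step hcy hN h)⟩,
        rfl, hcy, hN⟩
    · push Not at hc
      refine (ht (.base (by simp) (fun z => ⟨fun hz => ?_, ?_⟩) (by simp))).elim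
      · by_contra hne
        simp only [Set.mem_empty_iff_false, or_false] at hne
        exact hc z hne hz
      · rintro (rfl | h)
        · exact hadj
        · exact h.elim
  choose next hn1 hn2 hn3 using hnext
  have hinj : Function.Injective next := by
    intro d d' hdd
    have e1 : d.1.2 = d'.1.2 := by rw [← hn1, ← hn1, hdd]
    have e2 : d.1.1 = d'.1.1 := by
      have h1 : G.Adj d'.1.2 d.1.1 := e1 ▸ (hn3 d _).2 (Or.inl rfl)
      rcases (hn3 d' _).1 h1 with h2 | h2
      · exact h2
      · rw [← hdd] at h2
        exact absurd h2.symm (hn2 d)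
    exact Subtype.ext (Prod.ext e2 e1)
  have hsurj : Function.Surjective next := Finite.injective_iff_surjective.1 hinj
  refine hcyc (isCycleGraph_of_two_regular hG ?_)
  have hall : ∀ v, ∃ d : S, d.1.2 = v := by
    refine forall_of_connected hG (P := fun v => ∃ d : S, d.1.2 = v)
      (v := x) ⟨⟨(y, x), hxy, hcon.1, hcon.2⟩, rfl⟩ ?_
    rintro _ z hz ⟨d, rfl⟩
    rcases (hn3 d z).1 hz with rfl | rfl
    · obtain ⟨d', rfl⟩ := hsurj d
      exact ⟨d', (hn1 d').symm⟩
    · exact ⟨next d, rfl⟩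
  intro v
  obtain ⟨d, rfl⟩ := hall v
  exact ⟨_, _, (hn2 d).symm, hn3 d⟩

theorem sum_le_nbrSum {f : V → ℝ} (hf : ∀ v, 0 ≤ f v) {v : V} (s : Finset V)
    (hs : ∀ w ∈ s, G.Adj v w) : ∑ w ∈ s, f w ≤ nbrSum G f v := by
  classical
  calc ∑ w ∈ s, f w = ∑ w ∈ s, if G.Adj v w then f w else 0 :=
        Finset.sum_congr rfl fun w hw => by simp [hs w hw]
    _ ≤ _ := Finset.sum_le_sum_of_subset_of_nonneg (Finset.subset_univ _) fun w _ _ => by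
        split_ifs
        exacts [hf w, le_rfl]

theorem nbrSum_eq_sum {f : V → ℝ} {v : V} (s : Finset V) (hs : ∀ w, G.Adj v w ↔ w ∈ s) :
    nbrSum G f v = ∑ w ∈ s, f w := by
  classical
  simp [nbrSum, hs]

theorem nbrSum_of_degree_two {f : V → ℝ} {v a b : V} (hab : a ≠ b)
    (h : ∀ z, G.Adj v z ↔ z = a ∨ z = b) : nbrSum G f v = f a + f b := by
  classical
  rw [nbrSum_eq_sum {a, b} (by simpa using h), Finset.sum_pair hab]

/-- For `lam ≤ 2` the values of `f` are concave along the path, so they do not increase up to the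
branch vertex `x`. There two further neighbours have values at least `f x / 2`, which forces `f y ≤
f x`. Thus equality holds throughout: there is no other neighbour, and the two have value exactly `f
x / 2` and are leaves. -/
theorem BranchEnd.of_lam_le_two {lam : ℝ} {f : V → ℝ} (hf : IsPerron G lam f) (hlam : lam ≤ 2)
    {y x : V} (h : BranchEnd G y x) (hxy : f x ≤ f y) :
    f x = f y ∧ ∃ u v, u ≠ v ∧ TreeEnd G {u, v} y x := by
  classical
  have hf0 : ∀ v, 0 ≤ f v := fun v => (hf.pos v).le
  have hge : ∀ {s : Finset V} {v : V}, (∀ w ∈ s, G.Adj v w) → ∑ w ∈ s, f w ≤ 2 * f v :=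
    fun {s v} hs => (sum_le_nbrSum hf0 s hs).trans
      (by rw [hf.eq]; exact mul_le_mul_of_nonneg_right hlam (hf0 v))
  induction h with
  | @base y x u v hy hu hv huy hvy huv =>
    have h1 : f x ≤ 2 * f u := by simpa using hge (s := {x}) (v := u) (by simpa using hu.symm)
    have h2 : f x ≤ 2 * f v := by simpa using hge (s := {x}) (v := v) (by simpa using hv.symm)
    have h3 : f y + (f u + f v) ≤ 2 * f x := by
      have := hge (s := {y, u, v}) (v := x) (by simp [hy, hu, hv])
      rwa [Finset.sum_insert (by simp [huy.symm, hvy.symm]), Finset.sum_pair huv] at this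
    have hleaf : ∀ w, G.Adj x w → 2 * f w = f x → ∀ z, G.Adj w z ↔ z = x := by
      refine fun w hw hwx z => ⟨fun hz => ?_, fun hz => hz ▸ hw.symm⟩
      by_contra hne
      have := hge (s := {x, z}) (v := w) (by simp [hw.symm, hz])
      rw [Finset.sum_pair (Ne.symm hne)] at this
      have := hf.pos z
      linarith
    refine ⟨by linarith, u, v, huv, .base (by simp [huy.symm, hvy.symm]) (fun z => ⟨fun hz => ?_, ?_⟩) ?_⟩
    · by_contra hne
      simp only [Set.mem_insert_iff, Set.mem_singleton_iff, not_or] at hne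
      have := hge (s := {z, y, u, v}) (v := x) (by simp [hy, hu, hv, hz])
      rw [Finset.sum_insert (by simp [hne]), Finset.sum_insert (by simp [huy.symm, hvy.symm]),
        Finset.sum_pair huv] at this
      have := hf.pos z
      linarith
    · rintro (rfl | rfl | rfl) <;> assumption
    · rintro w (rfl | rfl)
      · exact hleaf _ hu (by linarith)
      · exact hleaf _ hv (by linarith)
  | @step y x c hc hN _ ih =>
    have h1 : f y + f c ≤ 2 * f x := by
      have := hge (s := {y, c}) (v := x) (by simp [hN])
      rwa [Finset.sum_pair hc.symm] at this
    obtain ⟨h2, u, v, huv, ht⟩ := ih (by linarith)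
    exact ⟨by linarith, u, v, huv, .step hc hN ht⟩

/-- If `lam ≤ 2`, starting from the endvertex with the larger value gives a fork of leaves and `f a
= f b`. This equality permits the same argument in the other direction, and two forks make an `H`
graph. -/
theorem two_lt_of_branchEnds {lam : ℝ} {f : V → ℝ} (hf : IsPerron G lam f) (hG : G.Connected)
    (hH : ¬ IsHGraph G) {a b : V} (h1 : BranchEnd G a b) (h2 : BranchEnd G b a) : 2 < lam := by
  by_contra! hlam
  have key : ∀ a b, BranchEnd G a b → BranchEnd G b a → f b ≤ f a → False := by
    intro a b h1 h2 hle
    obtain ⟨e1, u, v, huv, ht⟩ := h1.of_lam_le_two hf hlam hle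
    obtain ⟨-, u', v', huv', ht'⟩ := h2.of_lam_le_two hf hlam e1.ge
    exact hH (isHGraph_of_treeEnd hG huv huv' ht ht')
  rcases le_total (f b) (f a) with h | h
  · exact key a b h1 h2 h
  · exact key b a h2 h1 h

end Classification

/-! ### Subdividing an edge -/

section Subdivision

variable {V : Type*} {G : SimpleGraph V} {a b : V} {n : ℕ}

theorem subdivideEdge_adj_inl_inl {v w : V} :
    (subdivideEdge G a b n).Adj (.inl v) (.inl w) ↔ G.Adj v w ∧ s(v, w) ≠ s(a, b) := Iff.rfl

theorem subdivideEdge_adj_inl_inr {v : V} {i : Fin n} :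
    (subdivideEdge G a b n).Adj (.inl v) (.inr i) ↔
      (v = a ∧ (i : ℕ) = 0) ∨ (v = b ∧ (i : ℕ) + 1 = n) := Iff.rfl

theorem subdivideEdge_adj_inr_inl {v : V} {i : Fin n} :
    (subdivideEdge G a b n).Adj (.inr i) (.inl v) ↔
      (v = a ∧ (i : ℕ) = 0) ∨ (v = b ∧ (i : ℕ) + 1 = n) := Iff.rfl

theorem subdivideEdge_adj_inr_inr {i j : Fin n} :
    (subdivideEdge G a b n).Adj (.inr i) (.inr j) ↔ (i : ℕ) + 1 = j ∨ (j : ℕ) + 1 = i := Iff.rfl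

theorem subdivideEdge_connected (hG : G.Connected) (hn : 1 ≤ n) :
    (subdivideEdge G a b n).Connected := by
  set S := subdivideEdge G a b n with hS
  have hnew : ∀ i : ℕ, ∀ hi : i < n, S.Reachable (.inl a) (.inr ⟨i, hi⟩) := by
    intro i
    induction i with
    | zero =>
      intro hi
      exact SimpleGraph.Adj.reachable (subdivideEdge_adj_inl_inr.2 (Or.inl ⟨rfl, rfl⟩))
    | succ i ih =>
      intro hi
      refine (ih (by omega)).trans (SimpleGraph.Adj.reachable ?_)
      exact subdivideEdge_adj_inr_inr.2 (Or.inl rfl)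
  have hb : S.Reachable (.inl a) (.inl b) := (hnew (n - 1) (by omega)).trans
    (SimpleGraph.Adj.reachable
      (subdivideEdge_adj_inr_inl.2 (Or.inr ⟨rfl, Nat.sub_add_cancel hn⟩)))
  have hall : ∀ z, S.Reachable (.inl a) z := by
    rintro (v | i)
    · refine forall_of_connected hG (P := fun v => S.Reachable (.inl a) (.inl v))
        (SimpleGraph.Reachable.refl _) (fun v w hvw hv => ?_) v
      by_cases h : s(v, w) = s(a, b)
      · rcases Sym2.eq_iff.1 h with ⟨-, rfl⟩ | ⟨-, rfl⟩
        · exact hb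
        · exact SimpleGraph.Reachable.refl _
      · exact hv.trans (SimpleGraph.Adj.reachable (subdivideEdge_adj_inl_inl.2 ⟨hvw, h⟩))
    · exact hnew i i.2
  exact SimpleGraph.connected_iff_exists_forall_reachable _ |>.2 ⟨_, hall⟩

/-- Reversing the new path. -/
def subdivideEdgeSwap (G : SimpleGraph V) (a b : V) (n : ℕ) :
    subdivideEdge G a b n ≃g subdivideEdge G b a n where
  toEquiv := Equiv.sumCongr (Equiv.refl V) Fin.revPerm
  map_rel_iff' := by
    rintro (v | i) (w | j)
    · simp [subdivideEdge_adj_inl_inl, Sym2.eq_swap (a := b)]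
    · simp only [Equiv.sumCongr_apply, Sum.map_inl, Sum.map_inr, Equiv.refl_apply,
        Fin.revPerm_apply, subdivideEdge_adj_inl_inr, Fin.val_rev]
      have e1 : n - (j + 1) = 0 ↔ (j : ℕ) + 1 = n := by omega
      have e2 : n - (j + 1) + 1 = n ↔ (j : ℕ) = 0 := by omega
      rw [e1, e2, or_comm]
    · simp only [Equiv.sumCongr_apply, Sum.map_inl, Sum.map_inr, Equiv.refl_apply,
        Fin.revPerm_apply, subdivideEdge_adj_inr_inl, Fin.val_rev]
      have e1 : n - (i + 1) = 0 ↔ (i : ℕ) + 1 = n := by omega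
      have e2 : n - (i + 1) + 1 = n ↔ (i : ℕ) = 0 := by omega
      rw [e1, e2, or_comm]
    · simp only [Equiv.sumCongr_apply, Sum.map_inr, Fin.revPerm_apply,
        subdivideEdge_adj_inr_inr, Fin.val_rev]
      omega

/-- Subdividing one or the other edge at a vertex of degree two yields isomorphic graphs. -/
theorem subdivideEdge_shift [Finite V] {x y c : V} (hc : c ≠ y)
    (hN : ∀ z, G.Adj x z ↔ z = y ∨ z = c) (hn : 1 ≤ n) :
    Nonempty (subdivideEdge G x y n ≃g subdivideEdge G c x n) := by
  classical
  have hyx : y ≠ x := by rintro rfl; exact G.irrefl ((hN y).2 (Or.inl rfl))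
  have hcx : c ≠ x := by rintro rfl; exact G.irrefl ((hN c).2 (Or.inr rfl))
  -- Both graphs contain a path from `c` to `y` through `x` and the new vertices, with `x` first in
  -- one and last in the other; `φ` matches them in order.
  let φ : V ⊕ Fin n → V ⊕ Fin n := fun z => match z with
    | .inl v => if v = x then .inr ⟨0, hn⟩ else .inl v
    | .inr i => if h : (i : ℕ) + 1 < n then .inr ⟨i + 1, h⟩ else .inl x
  have hφx : φ (.inl x) = .inr ⟨0, hn⟩ := if_pos rfl
  have hφv : ∀ v, v ≠ x → φ (.inl v) = .inl v := fun v hv => if_neg hv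
  have hφi : ∀ (i : Fin n) (h : (i : ℕ) + 1 < n), φ (.inr i) = .inr ⟨i + 1, h⟩ := fun i h => dif_pos h
  have hφl : ∀ i : Fin n, (i : ℕ) + 1 = n → φ (.inr i) = .inl x := fun i h => dif_neg (by omega)
  have hlast : ∀ i : Fin n, (i : ℕ) + 1 < n ∨ (i : ℕ) + 1 = n := fun i => by omega
  have hinj : Function.Injective φ := by
    rintro (v | i) (w | j) hij
    · by_cases hv : v = x <;> by_cases hw : w = x
      · rw [hv, hw]
      · rw [hv, hφx, hφv w hw] at hij; cases hij
      · rw [hw, hφx, hφv v hv] at hij; cases hij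
      · rwa [hφv v hv, hφv w hw] at hij
    · by_cases hv : v = x <;> rcases hlast j with hj | hj
      · rw [hv, hφx, hφi j hj] at hij; simp at hij
      · rw [hv, hφx, hφl j hj] at hij; cases hij
      · rw [hφv v hv, hφi j hj] at hij; cases hij
      · rw [hφv v hv, hφl j hj] at hij; exact absurd (Sum.inl.inj hij) hv
    · by_cases hw : w = x <;> rcases hlast i with hi | hi
      · rw [hw, hφx, hφi i hi] at hij; simp at hij
      · rw [hw, hφx, hφl i hi] at hij; cases hij
      · rw [hφv w hw, hφi i hi] at hij; cases hij
      · rw [hφv w hw, hφl i hi] at hij; exact absurd (Sum.inl.inj hij).symm hw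
    · congr 1
      ext
      rcases hlast i with hi | hi <;> rcases hlast j with hj | hj
      · rw [hφi i hi, hφi j hj] at hij; simpa using hij
      · rw [hφi i hi, hφl j hj] at hij; cases hij
      · rw [hφl i hi, hφi j hj] at hij; cases hij
      · omega
  have hll : ∀ v w, (subdivideEdge G c x n).Adj (φ (.inl v)) (φ (.inl w)) ↔
      (subdivideEdge G x y n).Adj (.inl v) (.inl w) := by
    have key : ∀ w, w ≠ x → ((subdivideEdge G c x n).Adj (φ (.inl x)) (φ (.inl w)) ↔
        (subdivideEdge G x y n).Adj (.inl x) (.inl w)) := by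
      intro w hw
      rw [hφx, hφv w hw, subdivideEdge_adj_inr_inl, subdivideEdge_adj_inl_inl, hN]
      simp only [hw, false_and, or_false, and_true, ne_eq, Sym2.eq_iff, true_and, hyx.symm]
      constructor
      · rintro rfl; exact ⟨Or.inr rfl, hc⟩
      · rintro ⟨rfl | rfl, h⟩
        · exact absurd rfl h
        · rfl
    intro v w
    by_cases hv : v = x <;> by_cases hw : w = x
    · rw [hv, hw]; simp
    · rw [hv]; exact key w hw
    · rw [hw, SimpleGraph.adj_comm, key v hv, SimpleGraph.adj_comm]
    · rw [hφv v hv, hφv w hw, subdivideEdge_adj_inl_inl, subdivideEdge_adj_inl_inl]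
      simp [hv, hw]
  have hlr : ∀ v i, (subdivideEdge G c x n).Adj (φ (.inl v)) (φ (.inr i)) ↔
      (subdivideEdge G x y n).Adj (.inl v) (.inr i) := by
    intro v i
    by_cases hv : v = x <;> rcases hlast i with hi | hi
    · subst hv
      rw [hφx, hφi i hi, subdivideEdge_adj_inr_inr, subdivideEdge_adj_inl_inr]
      simp only [hyx.symm, false_and, or_false, true_and]
      omega
    · subst hv
      rw [hφx, hφl i hi, subdivideEdge_adj_inr_inl, subdivideEdge_adj_inl_inr]
      simp only [hyx.symm, hcx.symm, false_and, or_false, true_and, false_or]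
      omega
    · rw [hφv v hv, hφi i hi, subdivideEdge_adj_inl_inr, subdivideEdge_adj_inl_inr]
      simp only [hv, false_and, or_false, false_or]
      omega
    · rw [hφv v hv, hφl i hi, subdivideEdge_adj_inl_inl, subdivideEdge_adj_inl_inr,
        SimpleGraph.adj_comm, hN]
      simp only [hv, false_and, false_or, hi, and_true, ne_eq, Sym2.eq_iff, or_false]
      constructor
      · rintro ⟨rfl | rfl, h⟩
        · rfl
        · exact absurd rfl h
      · rintro rfl; exact ⟨Or.inl rfl, hc.symm⟩
  refine ⟨⟨Equiv.ofBijective φ (Finite.injective_iff_bijective.1 hinj), ?_⟩⟩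
  rintro (v | i) (w | j)
  · exact hll v w
  · exact hlr v j
  · exact (SimpleGraph.adj_comm _ _ _).trans ((hlr w i).trans (SimpleGraph.adj_comm _ _ _))
  · simp only [Equiv.ofBijective_apply]
    rw [subdivideEdge_adj_inr_inr]
    rcases hlast i with hi | hi <;> rcases hlast j with hj | hj
    · rw [hφi i hi, hφi j hj, subdivideEdge_adj_inr_inr]
      simp
    · rw [hφi i hi, hφl j hj, subdivideEdge_adj_inr_inl]
      simp only [hcx.symm, false_and, true_and, false_or]
      omega
    · rw [hφl i hi, hφi j hj, subdivideEdge_adj_inl_inr]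
      simp only [hcx.symm, false_and, true_and, false_or]
      omega
    · rw [hφl i hi, hφl j hj]
      refine iff_of_false (SimpleGraph.irrefl _) ?_
      omega

variable [Fintype V]

theorem nbrSum_subdivideEdge_new {x y : V} (hxy : x ≠ y) (g : V ⊕ Fin n → ℝ) (i : Fin n) :
    nbrSum (subdivideEdge G x y n) g (.inr i) =
      (if (i : ℕ) = 0 then g (.inl x) else g (.inr ⟨i - 1, by omega⟩)) +
      (if h : (i : ℕ) + 1 = n then g (.inl y) else g (.inr ⟨i + 1, by omega⟩)) := by
  have key := nbrSum_of_degree_two (G := subdivideEdge G x y n) (f := g) (v := .inr i)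
    (a := if h : (i : ℕ) = 0 then .inl x else .inr ⟨i - 1, by omega⟩)
    (b := if h : (i : ℕ) + 1 = n then .inl y else .inr ⟨i + 1, by omega⟩) ?_ ?_
  · rw [key]
    congr 1 <;> split_ifs <;> rfl
  · split_ifs
    · simpa using hxy
    · simp
    · simp
    · simp only [ne_eq, Sum.inr.injEq, Fin.mk.injEq]
      omega
  · rintro (v | j)
    · rw [subdivideEdge_adj_inr_inl]
      split_ifs <;> simp only [Sum.inl.injEq, or_false, false_or] <;> tauto
    · rw [subdivideEdge_adj_inr_inr]
      split_ifs <;> simp only [or_false, false_or, iff_false, Sum.inr.injEq, Fin.ext_iff] <;> omega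

theorem nbrSum_subdivideEdge_other {x y v : V} (hx : v ≠ x) (hy : v ≠ y) (g : V ⊕ Fin n → ℝ) :
    nbrSum (subdivideEdge G x y n) g (.inl v) = nbrSum G (fun w => g (.inl w)) v := by
  classical
  rw [nbrSum, nbrSum, Fintype.sum_sum_type]
  simp [subdivideEdge_adj_inl_inl, subdivideEdge_adj_inl_inr, hx, hy]

theorem nbrSum_subdivideEdge_left {x y : V} (hxy : G.Adj x y) (hn : 0 < n) (g : V ⊕ Fin n → ℝ) :
    nbrSum (subdivideEdge G x y n) g (.inl x) =
      nbrSum G (fun w => g (.inl w)) x - g (.inl y) + g (.inr ⟨0, hn⟩) := by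
  classical
  rw [nbrSum, nbrSum, Fintype.sum_sum_type]
  congr 1
  · rw [eq_sub_iff_add_eq]
    have : g (.inl y) = ∑ w, if w = y then g (.inl w) else 0 := by simp
    rw [this, ← Finset.sum_add_distrib]
    refine Finset.sum_congr rfl fun w _ => ?_
    rw [subdivideEdge_adj_inl_inl]
    by_cases h : w = y
    · subst h; simp [hxy]
    · simp [h, hxy.ne]
  · have h1 : ∀ i : Fin n, (subdivideEdge G x y n).Adj (.inl x) (.inr i) ↔ i = ⟨0, hn⟩ := fun i => by
      rw [subdivideEdge_adj_inl_inr, Fin.ext_iff]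
      simp [hxy.ne]
    simp [h1]

theorem nbrSum_subdivideEdge_right {x y : V} (hxy : G.Adj x y) (hn : 0 < n) (g : V ⊕ Fin n → ℝ) :
    nbrSum (subdivideEdge G x y n) g (.inl y) =
      nbrSum G (fun w => g (.inl w)) y - g (.inl x) + g (.inr ⟨n - 1, by omega⟩) := by
  have h := nbrSum_iso (subdivideEdgeSwap G x y n)
    (fun z => g ((subdivideEdgeSwap G x y n).symm z)) (.inl y)
  simp only [RelIso.symm_apply_apply] at h
  rw [h]
  exact nbrSum_subdivideEdge_left hxy.symm hn _

end Subdivision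

/-! ### Subinvariant vectors on the subdivided graph -/

section Subinvariant

variable {V : Type*} [Fintype V] {G : SimpleGraph V}

/-- There is a positive vector which is subinvariant for `lam`, strictly at some vertex. -/
def HasStrictSubinvariant (G : SimpleGraph V) (lam : ℝ) : Prop :=
  ∃ g : V → ℝ, (∀ v, 0 < g v) ∧ (∀ v, nbrSum G g v ≤ lam * g v) ∧ ∃ v, nbrSum G g v < lam * g v

theorem HasStrictSubinvariant.iso {W : Type*} [Fintype W] {H : SimpleGraph W} (φ : G ≃g H) {lam : ℝ}
    (h : HasStrictSubinvariant H lam) : HasStrictSubinvariant G lam := by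
  obtain ⟨g, h1, h2, w, h3⟩ := h
  refine ⟨fun v => g (φ v), fun v => h1 _, fun v => by rw [nbrSum_iso]; exact h2 _, φ.symm w, ?_⟩
  simpa only [nbrSum_iso, φ.apply_symm_apply] using h3

/-- Subdivision with constant values on the new vertices. -/
theorem hasStrictSubinvariant_of_le {lam : ℝ} {f : V → ℝ} (hf : IsPerron G lam f) (hlam : 2 < lam)
    {x y : V} (hxy : G.Adj x y) {n : ℕ} (hn : 0 < n) (hle : f x ≤ f y)
    (hs : f x ≤ lam * f x - f y) : HasStrictSubinvariant (subdivideEdge G x y n) lam := by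
  -- With the smaller value `f x` on the new path, nothing changes at `y`, and `x` sees `f x`
  -- instead of `f y`. A new vertex sees at most `f x + f y`, which is at most `lam * f x` by `hs`.
  set g : V ⊕ Fin n → ℝ := Sum.elim f (fun _ => f x) with hg
  have hx := nbrSum_subdivideEdge_left hxy hn g
  have hy := nbrSum_subdivideEdge_right hxy hn g
  have hfg : (fun w => g (.inl w)) = f := rfl
  rw [hfg, hf.eq] at hx hy
  have hnew : ∀ i : Fin n, nbrSum (subdivideEdge G x y n) g (.inr i) ≤ f x + f y := by
    intro i
    rw [nbrSum_subdivideEdge_new hxy.ne]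
    refine add_le_add ?_ ?_ <;> split_ifs <;> simp [hg, hle]
  simp only [hg, Sum.elim_inl, Sum.elim_inr] at hx hy
  refine ⟨g, ?_, ?_, ?_⟩
  · rintro (v | i)
    exacts [hf.pos v, hf.pos x]
  · rintro (v | i)
    · by_cases h1 : v = x
      · subst h1
        simp only [hg, Sum.elim_inl]
        linarith
      by_cases h2 : v = y
      · subst h2
        simp only [hg, Sum.elim_inl]
        linarith
      rw [nbrSum_subdivideEdge_other h1 h2, hfg, hf.eq]
      rfl
    · refine (hnew i).trans ?_
      simp only [hg, Sum.elim_inr]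
      linarith
  -- If `f x = f y`, strictness at a new vertex comes from `2 < lam`; otherwise it occurs at `x`.
  · rcases hle.eq_or_lt with h | h
    · refine ⟨.inr ⟨0, hn⟩, (hnew _).trans_lt ?_⟩
      simp only [hg, Sum.elim_inr]
      have := mul_lt_mul_of_pos_right hlam (hf.pos x)
      linarith
    · refine ⟨.inl x, ?_⟩
      simp only [hg, Sum.elim_inl]
      linarith

/-- Subdivision next to a vertex of degree at least three. -/
theorem hasStrictSubinvariant_of_degree {lam : ℝ} {f : V → ℝ} (hf : IsPerron G lam f)
    (hlam : 2 < lam) {x y u v : V} (hxy : G.Adj x y) (hu : G.Adj x u) (hv : G.Adj x v) (huy : u ≠ y)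
    (hvy : v ≠ y) (huv : u ≠ v) {n : ℕ} (hn : 0 < n) (hs : lam * f x - f y < f x) :
    HasStrictSubinvariant (subdivideEdge G x y n) lam := by
  classical
  -- `s` is the sum of `f` over the neighbours of `x` other than `y`.
  set s := lam * f x - f y with hs'
  have hf0 : ∀ v, 0 ≤ f v := fun v => (hf.pos v).le
  have hlu : f x ≤ lam * f u := by rw [← hf.eq]; exact le_nbrSum hf0 hu.symm
  have hlv : f x ≤ lam * f v := by rw [← hf.eq]; exact le_nbrSum hf0 hv.symm
  have hsuv : f u + f v ≤ s := by
    have := sum_le_nbrSum (G := G) hf0 (v := x) {y, u, v} (by simp [hxy, hu, hv])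
    rw [Finset.sum_insert (by simp [huy.symm, hvy.symm]), Finset.sum_pair huv, hf.eq] at this
    linarith
  have hs0 : 0 < s := (add_pos (hf.pos u) (hf.pos v)).trans_le hsuv
  -- The average of `2 * f x ≤ lam * s`, from the two extra neighbours, and `2 * s < lam * s`.
  have hkey : s + f x < lam * s := by
    have h1 : lam * (f u + f v) ≤ lam * s := mul_le_mul_of_nonneg_left hsuv (by linarith)
    have h2 : 2 * s < lam * s := mul_lt_mul_of_pos_right hlam hs0
    linarith
  set f' : V → ℝ := fun w => f w + (s - f x) * (Pi.single x 1 : V → ℝ) w with hf'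
  have hf'x : f' x = s := by simp [hf']
  have hf'v : ∀ w, w ≠ x → f' w = f w := fun w hw => by simp [hf', hw]
  have hf'le : ∀ w, f' w ≤ f w := fun w => by
    by_cases hw : w = x
    · rw [hw, hf'x]; exact hs.le
    · exact (hf'v w hw).le
  have hf'y : nbrSum G f' y = lam * f y + (s - f x) := by
    have h1 : nbrSum G (Pi.single x 1) y = 1 := by
      rw [nbrSum, Finset.sum_eq_single x] <;> simp +contextual [hxy.symm]
    rw [hf', nbrSum_add_smul, hf.eq, h1, mul_one]
  have hf'mono : ∀ w, nbrSum G f' w ≤ lam * f w := fun w => (nbrSum_mono hf'le w).trans (hf.eq w).le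
  -- The value at `x` is lowered to `s`, and the new path carries `s` except for `f x` next to `y`.
  -- So `y` sees what it saw before, the last new vertex sees exactly `s + f y = lam * f x`, and
  -- `hkey` settles `x` and the other new vertices.
  set g : V ⊕ Fin n → ℝ := Sum.elim f' (fun i => if (i : ℕ) + 1 = n then f x else s) with hg
  have hx := nbrSum_subdivideEdge_left hxy hn g
  have hy := nbrSum_subdivideEdge_right hxy hn g
  have hfg : (fun w => g (.inl w)) = f' := rfl
  have hgs : ∀ i : Fin n, g (.inr i) ≤ f x := fun i => by
    simp only [hg, Sum.elim_inr]; split_ifs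
    exacts [le_rfl, hs.le]
  have hglast : g (.inr ⟨n - 1, by omega⟩) = f x := if_pos (by simp only; omega)
  have hgx : g (.inl x) = s := hf'x
  have hgy : g (.inl y) = f y := hf'v y hxy.ne'
  rw [hfg] at hx hy
  have hxlt : nbrSum (subdivideEdge G x y n) g (.inl x) < lam * g (.inl x) := by
    have := hf'mono x
    have := hgs ⟨0, hn⟩
    rw [hx, hgx, hgy]
    linarith
  refine ⟨g, ?_, ?_, .inl x, hxlt⟩
  · rintro (w | i)
    · by_cases hw : w = x
      · rw [hw, hgx]; exact hs0
      · exact (hf.pos w).trans_le (hf'v w hw).ge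
    · simp only [hg, Sum.elim_inr]; split_ifs
      exacts [hf.pos x, hs0]
  · rintro (w | i)
    · by_cases h1 : w = x
      · rw [h1]; exact hxlt.le
      by_cases h2 : w = y
      · rw [h2, hy, hgx, hgy, hglast, hf'y]
        linarith
      rw [nbrSum_subdivideEdge_other h1 h2, hfg]
      exact (hf'mono w).trans (by rw [← hf'v w h1]; rfl)
    · rw [nbrSum_subdivideEdge_new hxy.ne]
      have ha : (if (i : ℕ) = 0 then g (.inl x) else g (.inr ⟨i - 1, by omega⟩)) = s := by
        split_ifs with h
        · exact hgx
        · exact if_neg (by simp only; omega)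
      rw [ha]
      by_cases hi : (i : ℕ) + 1 = n
      · have : g (.inr i) = f x := if_pos hi
        rw [dif_pos hi, hgy, this]
        linarith
      · have : g (.inr i) = s := if_neg hi
        rw [dif_neg hi, this]
        have := hgs ⟨i + 1, by omega⟩
        linarith

/-- Descent on `f x`. If neither construction above applies, `x` has a single further neighbour `c`,
and `f c = lam * f x - f y < f x`. The subdivision can then be moved to the edge `c x`. Having no
further neighbour is ruled out because the edge does not lead to a path end. -/
theorem hasStrictSubinvariant_subdivideEdge {lam : ℝ} {f : V → ℝ} (hf : IsPerron G lam f)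
    (hlam : 2 < lam) {n : ℕ} (hn : 1 ≤ n) (x : V) :
    ∀ y, G.Adj x y → f x ≤ f y → ¬ TreeEnd G ∅ y x →
      HasStrictSubinvariant (subdivideEdge G x y n) lam := by
  have hwf : WellFounded fun a b : V => f a < f b :=
    have : IsTrans V fun a b => f a < f b := ⟨fun _ _ _ h1 h2 => h1.trans h2⟩
    have : Std.Irrefl fun a b : V => f a < f b := ⟨fun _ => lt_irrefl _⟩
    Finite.wellFounded_of_trans_of_irrefl _
  induction x using hwf.induction with
  | _ x ih =>
    intro y hxy hle ht
    rcases le_or_gt (f x) (lam * f x - f y) with hs | hs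
    · exact hasStrictSubinvariant_of_le hf hlam hxy hn hle hs
    by_cases hc : ∃ c, c ≠ y ∧ G.Adj x c
    · obtain ⟨c, hcy, hxc⟩ := hc
      by_cases hd : ∃ d, d ≠ y ∧ d ≠ c ∧ G.Adj x d
      · obtain ⟨d, hdy, hdc, hxd⟩ := hd
        exact hasStrictSubinvariant_of_degree hf hlam hxy hxc hxd hcy hdy hdc.symm hn hs
      · push Not at hd
        have hN : ∀ z, G.Adj x z ↔ z = y ∨ z = c := by
          refine fun z => ⟨fun hz => ?_, ?_⟩
          · by_contra! hne
            exact hd z hne.1 hne.2 hz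
          · rintro (rfl | rfl) <;> assumption
        have hfc : f c < f x := by
          have := nbrSum_of_degree_two (f := f) hcy.symm hN
          rw [hf.eq] at this
          linarith
        obtain ⟨φ⟩ := subdivideEdge_shift hcy hN hn
        exact (ih c hfc x hxc.symm hfc.le fun h => ht (.step hcy hN h)).iso φ
    · push Not at hc
      refine (ht (.base (by simp) (fun z => ⟨fun hz => ?_, ?_⟩) (by simp))).elim
      · by_contra hne
        simp only [Set.mem_empty_iff_false, or_false] at hne
        exact hc z hne hz
      · rintro (rfl | h)
        · exact hxy
        · exact h.elim

/-- Internality excludes a path end on either side, so both sides branch and `lam > 2`. The descent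
starts at the endvertex with the smaller value. -/
theorem hasStrictSubinvariant_of_isInternalEdge {lam : ℝ} {f : V → ℝ} (hf : IsPerron G lam f)
    (hG : G.Connected) (hcyc : ¬ IsCycleGraph G) (hH : ¬ IsHGraph G) {a b : V}
    (he : IsInternalEdge G s(a, b)) {n : ℕ} (hn : 1 ≤ n) :
    HasStrictSubinvariant (subdivideEdge G a b n) lam := by
  have hab : G.Adj a b := he.1
  have h1 : ¬ TreeEnd G ∅ a b := fun h => he.2 h.liesOnEndpath
  have h2 : ¬ TreeEnd G ∅ b a := fun h => he.2 (Sym2.eq_swap ▸ h.liesOnEndpath)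
  have hlam : 2 < lam := two_lt_of_branchEnds hf hG hH
    ((treeEnd_or_branchEnd hG hcyc hab.symm).resolve_left h1)
    ((treeEnd_or_branchEnd hG hcyc hab).resolve_left h2)
  rcases le_total (f a) (f b) with h | h
  · exact hasStrictSubinvariant_subdivideEdge hf hlam hn a b hab h h2
  · exact (hasStrictSubinvariant_subdivideEdge hf hlam hn b a hab.symm h h1).iso
      (subdivideEdgeSwap G a b n)

theorem exists_entry_ne_zero {t u : ℕ} {M : Matrix (Fin t) (Fin u) SignType}
    {x y : Fin t ⊕ Fin u} (h : (rowColumnGraph M).Adj x y) : ∃ i j, M i j ≠ 0 := by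
  rcases x with i | j <;> rcases y with i' | j'
  · exact h.elim
  · exact ⟨i, j', h⟩
  · exact ⟨i', j, h⟩
  · exact h.elim

end Subinvariant
end GridClass

theorem mainTheorem11 {t u t' u' : ℕ}
    (M : Matrix (Fin t) (Fin u) SignType) (M' : Matrix (Fin t') (Fin u') SignType)
    (hconn : (GridClass.rowColumnGraph M).Connected)
    (e : Sym2 (Fin t ⊕ Fin u))
    (he : GridClass.IsInternalEdge (GridClass.rowColumnGraph M) e)
    (hsub : GridClass.IsSubdivisionAt (GridClass.rowColumnGraph M) e
      (GridClass.rowColumnGraph M'))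
    (hcycle : ¬ GridClass.IsCycleGraph (GridClass.rowColumnGraph M))
    (hH : ¬ GridClass.IsHGraph (GridClass.rowColumnGraph M)) :
    ∃ g g' : ℝ, GridClass.HasGrowthRate (GridClass.Grid M) g ∧
      GridClass.HasGrowthRate (GridClass.Grid M') g' ∧ g' < g := by
  obtain ⟨a, b, n, rfl, hn, ⟨φ⟩⟩ := hsub
  obtain ⟨lam, f, hf⟩ := GridClass.exists_isPerron hconn
  have hab : (GridClass.rowColumnGraph M).Adj a b := he.1
  obtain ⟨i, j, hM⟩ := GridClass.exists_entry_ne_zero hab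
  have hS := GridClass.subdivideEdge_connected (a := a) (b := b) hconn hn
  obtain ⟨lam', f', hf'⟩ := GridClass.exists_isPerron hS
  have hadj : (GridClass.subdivideEdge (GridClass.rowColumnGraph M) a b n).Adj
      (.inl a) (.inr ⟨0, hn⟩) := GridClass.subdivideEdge_adj_inl_inr.2 (Or.inl ⟨rfl, rfl⟩)
  -- The first edge of the new path supplies a nonzero entry of `M'`, as the growth rate formula
  -- requires.
  obtain ⟨i', j', hM'⟩ := GridClass.exists_entry_ne_zero (φ.symm.map_adj_iff.2 hadj)
  obtain ⟨g, hg1, hg2, v, hg3⟩ :=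
    GridClass.hasStrictSubinvariant_of_isInternalEdge hf hconn hcycle hH he hn
  have hlt : lam' < lam := hf'.lt_of_subinvariant hg2 hg1 hg3
  exact ⟨lam ^ 2, lam' ^ 2, GridClass.hasGrowthRate_grid hf hM,
    GridClass.hasGrowthRate_grid (hf'.iso φ) hM',
    pow_lt_pow_left₀ hlt (hf'.lam_pos hadj).le two_ne_zero⟩
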